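/- **Theorem 3 (GRCS runtime).** Let $Q$ and $P$ be continuous (atomless) probability distributions over $\mathbb{R}$ with $Q \ll P$ and unimodal density ratio $r = dQ/dP$, i.e. some version of $r$ is nondecreasing up to a mode $m \in [-\infty, \infty]$ and nonincreasing from $m$ on. Run Greedy Rejection Coding with the sample-splitting partitioning process (GRCS). That is, set $S_0 = \mathbb{R}$ and $T_0 = 0$, and for $d = 0, 1, 2, \dots$: - draw $X_d \sim P|_{S_d}/P(S_d)$ and independently $U_d \sim \mathrm{Uniform}(0,1)$; let $\alpha_{d+1}(x) = \min\{r(x) - \frac{dT_d}{dP}(x),\ (1 - T_d(\mathbb{R}))/P(S_d)\}$, $A_{d+1}(B) = \int_B \alpha_{d+1}\,dP$ and $\beta_{d+1}(x) = \alpha_{d+1}(x)\,P(S_d)/(1 - T_d(\mathbb{R}))$; if $U_d \le \beta_{d+1}(X_d)$, accept $X_d$ and stop; - otherwise split $S_d$ at $X_d$ into $S_d \cap (-\infty, X_d]$ and $R = S_d \cap [X_d, \infty)$, and let $S_{d+1}$ be $R$ with probability $\frac{Q(R) - T_d(R) - A_{d+1}(R)}{Q(S_d) - T_d(S_d) - A_{d+1}(S_d)}$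 and the other part with the complementary probability; put $T_{d+1}(B) = T_d(B \cap S_{d+1}) + A_{d+1}(B \cap S_{d+1}) + Q(B \setminus S_{d+1})$. Let $D \in \{0, 1, 2, \dots\} \cup \{\infty\}$ be the number of (rejecting) steps before the step that accepts a sample. Then, with $D_{\mathrm{KL}}$ in bits, $\log = \log_2$ and $\beta = 2/\log(4/3) \approx 4.82$, $$\mathbb{E}[D] \le \beta\, D_{\mathrm{KL}}(Q\|P) + 4,$$ so that $\mathbb{E}[D] \le \beta\, D_{\mathrm{KL}}(Q\|P) + \mathcal{O}(1)$ with a universal constant, and in fact $$\mathbb{E}[D] \le \frac{D_{\mathrm{KL}}(Q\|P)}{\log(4/3)} + 4.$$ -/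

import Mathlib

open MeasureTheory Set
open scoped ENNReal

noncomputable section

namespace GRC

/-! ### Greedy rejection coding along a branch `S 0, S 1, …` of a partitioning process -/

section Recursion

variable {𝒳 : Type*} [MeasurableSpace 𝒳]

/-- With `t` the density (with respect to `P`) of the target mass that has been ruled out so far and
`s` the active set, this is `α = min (dQ/dP - t) ((1 - T(𝒳)) / P(s))`, where `T = t · P`. -/
def acceptDensity (Q P : Measure 𝒳) (t : 𝒳 → ℝ≥0∞) (s : Set 𝒳) (x : 𝒳) : ℝ≥0∞ :=
  min (Q.rnDeriv P x - t x) ((1 - P.withDensity t univ) / P s)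

open Classical in
/-- The density `t_d = dT_d/dP` of the ruled out measure `T_d`: it starts at `0`; at each step the
mass that could just be accepted is added on the new active set, and everything outside the new
active set is ruled out. Being an explicit function, it is a fixed version of the density. -/
def ruledOutDensity (Q P : Measure 𝒳) (S : ℕ → Set 𝒳) : ℕ → 𝒳 → ℝ≥0∞
  | 0 => fun _ => 0
  | d + 1 => fun x =>
      if x ∈ S (d + 1) then
        ruledOutDensity Q P S d x + acceptDensity Q P (ruledOutDensity Q P S d) (S d) x
      else Q.rnDeriv P x

/-- The ruled out measure `T_d`. -/
def ruledOut (Q P : Measure 𝒳) (S : ℕ → Set 𝒳) (d : ℕ) : Measure 𝒳 :=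
  P.withDensity (ruledOutDensity Q P S d)

/-- The function `α_{d+1}`. -/
def alpha (Q P : Measure 𝒳) (S : ℕ → Set 𝒳) (d : ℕ) : 𝒳 → ℝ≥0∞ :=
  acceptDensity Q P (ruledOutDensity Q P S d) (S d)

/-- The measure `A_{d+1}` with density `α_{d+1}` with respect to `P`. -/
def accepted (Q P : Measure 𝒳) (S : ℕ → Set 𝒳) (d : ℕ) : Measure 𝒳 :=
  P.withDensity (alpha Q P S d)

/-- The acceptance probability `β_{d+1}(x) = α_{d+1}(x) · P(S_d) / (1 - T_d(𝒳))`. -/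
def acceptProb (Q P : Measure 𝒳) (S : ℕ → Set 𝒳) (d : ℕ) (x : 𝒳) : ℝ≥0∞ :=
  alpha Q P S d x * (P (S d) / (1 - ruledOut Q P S d univ))

/-- The probability with which the branch is continued into the child `R` of `S_d`: the fraction of
the target mass on `S_d`, not accounted for up to and including step `d`, that lies in `R`. -/
def branchProb (Q P : Measure 𝒳) (S : ℕ → Set 𝒳) (d : ℕ) (R : Set 𝒳) : ℝ≥0∞ :=
  (Q R - ruledOut Q P S d R - accepted Q P S d R) /
    (Q (S d) - ruledOut Q P S d (S d) - accepted Q P S d (S d))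

theorem measurable_ruledOutDensity (Q P : Measure 𝒳) {S : ℕ → Set 𝒳}
    (hS : ∀ d, MeasurableSet (S d)) (d : ℕ) : Measurable (ruledOutDensity Q P S d) := by
  induction d with
  | zero => exact measurable_const
  | succ d ih =>
    refine Measurable.ite (hS (d + 1)) (ih.add ?_) (Measure.measurable_rnDeriv Q P)
    exact ((Measure.measurable_rnDeriv Q P).sub ih).min measurable_const

theorem ruledOut_zero (Q P : Measure 𝒳) (S : ℕ → Set 𝒳) : ruledOut Q P S 0 = 0 :=
  withDensity_zero

/-- `T_{d+1}(B) = T_d(B ∩ S_{d+1}) + A_{d+1}(B ∩ S_{d+1}) + Q(B ∩ S_{d+1}ᶜ)`. -/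
theorem ruledOut_succ (Q P : Measure 𝒳) [IsFiniteMeasure Q] [IsFiniteMeasure P] (hQP : Q ≪ P)
    {S : ℕ → Set 𝒳} (hS : ∀ d, MeasurableSet (S d)) (d : ℕ) {B : Set 𝒳} (hB : MeasurableSet B) :
    ruledOut Q P S (d + 1) B =
      ruledOut Q P S d (B ∩ S (d + 1)) + accepted Q P S d (B ∩ S (d + 1))
        + Q (B ∩ (S (d + 1))ᶜ) := by
  have h1 := hB.inter (hS (d + 1))
  have h2 := hB.inter (hS (d + 1)).compl
  have hm := measurable_ruledOutDensity Q P hS d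
  unfold ruledOut accepted
  rw [← measure_inter_add_sdiff B (hS (d + 1)), sdiff_eq, withDensity_apply _ h1,
    withDensity_apply _ h2, withDensity_apply _ h1, withDensity_apply _ h1,
    ← lintegral_add_left hm, ← Measure.setLIntegral_rnDeriv hQP]
  congr 1
  · exact setLIntegral_congr_fun h1 fun x hx => if_pos hx.2
  · exact setLIntegral_congr_fun h2 fun x hx => if_neg hx.2

end Recursion

/-! ### The sample-splitting partitioning process and the heap indices -/

/-- The cells of the sample-splitting process with sample `x n` at the node with heap index `n`:
the root (index `1`) is the real line, and the cell `[a, b]` of node `n` has the children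
`[a, x n]` (index `2 * n`) and `[x n, b]` (index `2 * n + 1`). -/
def splitCell (x : ℕ → ℝ) (n : ℕ) : Set ℝ :=
  if n ≤ 1 then univ
  else if n % 2 = 0 then splitCell x (n / 2) ∩ Iic (x (n / 2))
  else splitCell x (n / 2) ∩ Ici (x (n / 2))
termination_by n
decreasing_by all_goals omega

theorem splitCell_one (x : ℕ → ℝ) : splitCell x 1 = univ := by
  rw [splitCell]; simp

theorem splitCell_two_mul (x : ℕ → ℝ) {n : ℕ} (hn : 1 ≤ n) :
    splitCell x (2 * n) = splitCell x n ∩ Iic (x n) := by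
  rw [splitCell, if_neg (by omega), if_pos (by omega), show 2 * n / 2 = n by omega]

theorem splitCell_two_mul_add_one (x : ℕ → ℝ) {n : ℕ} (hn : 1 ≤ n) :
    splitCell x (2 * n + 1) = splitCell x n ∩ Ici (x n) := by
  rw [splitCell, if_neg (by omega), if_neg (by omega), show (2 * n + 1) / 2 = n by omega]

/-- The heap index `I_d`: `I_0 = 1` and `I_{d+1} = 2 I_d + b_d`. -/
def heapIndex (b : ℕ → Bool) : ℕ → ℕ
  | 0 => 1
  | d + 1 => 2 * heapIndex b d + (b d).toNat

/-- The active set `S_d = Z_{I_d}`. -/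
def activeSet (x : ℕ → ℝ) (b : ℕ → Bool) (d : ℕ) : Set ℝ :=
  splitCell x (heapIndex b d)

/-- Step `d` accepts: `U_{I_d} ≤ β_{d+1}(X_{I_d}, S_{0:d})`. -/
def Accepts (Q P : Measure ℝ) (x u : ℕ → ℝ) (b : ℕ → Bool) (d : ℕ) : Prop :=
  ENNReal.ofReal (u (heapIndex b d)) ≤ acceptProb Q P (activeSet x b) d (x (heapIndex b d))

/-- The number of (rejecting) steps before the accepting step, i.e. the least `d` such that step
`d` accepts (steps are counted from `0`); it is `⊤` if no step accepts. -/
def numSteps (Q P : Measure ℝ) (x u : ℕ → ℝ) (b : ℕ → Bool) : ℕ∞ :=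
  ⨅ (d : ℕ) (_ : Accepts Q P x u b d), (d : ℕ∞)

/-! ### Runs of GRC with the sample-splitting process (GRCS) -/

section Run

variable {Ω : Type*} [MeasurableSpace Ω]

/-- The heap index `I_d` as a random variable. -/
def idx (b : ℕ → Ω → Bool) (d : ℕ) (ω : Ω) : ℕ := heapIndex (fun j => b j ω) d

/-- The active sets `S_0, S_1, …` as random sets. -/
def active (X : ℕ → Ω → ℝ) (b : ℕ → Ω → Bool) (ω : Ω) : ℕ → Set ℝ :=
  activeSet (fun n => X n ω) (fun j => b j ω)

/-- The pair `(X_{I_d}, U_{I_d})`. -/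
def drawn (X U : ℕ → Ω → ℝ) (b : ℕ → Ω → Bool) (d : ℕ) (ω : Ω) : ℝ × ℝ :=
  (X (idx b d ω) ω, U (idx b d ω) ω)

/-- The random number `D` of steps before acceptance. -/
def steps (Q P : Measure ℝ) (X U : ℕ → Ω → ℝ) (b : ℕ → Ω → Bool) (ω : Ω) : ℕ∞ :=
  numSteps Q P (fun n => X n ω) (fun n => U n ω) (fun j => b j ω)

/-- The σ-algebra generated by all draws and coin tosses made in the steps before step `d`. -/
@[reducible] def past (X U : ℕ → Ω → ℝ) (b : ℕ → Ω → Bool) (d : ℕ) : MeasurableSpace Ω :=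
  ⨆ (j : ℕ) (_ : j < d), MeasurableSpace.comap (fun ω => (drawn X U b j ω, b j ω)) inferInstance

/-- The random variables `X n`, `U n` (sample and uniform variable at the node `n`) and `b d` (coin
toss of step `d`) form a run of GRC with target `Q`, proposal `P` and the sample-splitting
process. The laws are prescribed only as long as no sample has been accepted. -/
structure IsGRCSRun (Q P : Measure ℝ) (μ : Measure Ω) (X U : ℕ → Ω → ℝ) (b : ℕ → Ω → Bool) :
    Prop where
  measurable_X : ∀ n, Measurable (X n)
  measurable_U : ∀ n, Measurable (U n)
  measurable_b : ∀ d, Measurable (b d)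
  /-- If step `d` is reached, then, conditionally on the past, `X_{I_d}` and `U_{I_d}` are
  independent with laws `P|_{S_d} / P(S_d)` and `Uniform(0, 1)`. -/
  draw : ∀ d (E : Set Ω), MeasurableSet[past X U b d] E →
    (∀ ω ∈ E, (d : ℕ∞) ≤ steps Q P X U b ω) →
    ∀ B : Set (ℝ × ℝ), MeasurableSet B →
      μ (E ∩ drawn X U b d ⁻¹' B) =
        ∫⁻ ω in E, ((ProbabilityTheory.cond P (active X b ω d)).prod
          (volume.restrict (Icc (0 : ℝ) 1))) B ∂μ
  /-- If step `d` rejects, then, conditionally on the past and on `X_{I_d}, U_{I_d}`, the coin `b_d`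
  is Bernoulli, its success probability being the one of moving to `Z_{2 I_d + 1}`. -/
  coin : ∀ d (E : Set Ω),
    MeasurableSet[past X U b d ⊔ MeasurableSpace.comap (drawn X U b d) inferInstance] E →
    (∀ ω ∈ E, (d : ℕ∞) < steps Q P X U b ω) →
      μ (E ∩ {ω | b d ω = true}) =
        ∫⁻ ω in E, branchProb Q P (active X b ω) d
          (splitCell (fun n => X n ω) (2 * idx b d ω + 1)) ∂μ

end Run

/-! ### Unimodality and relative entropy -/

/-- `dQ/dP` is unimodal: some version of it is nondecreasing up to a mode `m ∈ [-∞, ∞]` and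
nonincreasing from `m` on. -/
def HasUnimodalRatio (Q P : Measure ℝ) : Prop :=
  ∃ (r : ℝ → ℝ≥0∞) (m : EReal), r =ᵐ[P] Q.rnDeriv P ∧
    MonotoneOn r {x : ℝ | (x : EReal) ≤ m} ∧ AntitoneOn r {x : ℝ | m ≤ (x : EReal)}

/-- The Kullback-Leibler divergence in bits. -/
def klBits (Q P : Measure ℝ) : ℝ≥0∞ :=
  InformationTheory.klDiv Q P / ENNReal.ofReal (Real.log 2)

end GRC

end

set_option linter.unusedSectionVars false

noncomputable section

namespace GRC

/-! ### Elementary inequalities -/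

/-! Write r = dQ/dP. Along any branch the ruled out density is r off the active set S and min(r, L)
on S for a single level L; a step raises L by W / P(S), where W = ∫_S (r - L)⁺ dP is the target mass
left (`ruledOutDensity_cell`). A proposal x with r(x) above the new level L' is surely accepted, so
a rejected x has r(x) ≤ L'. By unimodality {r > L'} then lies on one side of x up to a null set, and
the coin is degenerate and follows it (`branchProb_zero_or_one`, `IsGRCSRun.ae_good`). Hence S
always contains {r > L} almost everywhere, W depends on L alone, and a step rejects with conditional
probability t = W'/W.

Without conditioning on rejection, a split would keep on average at most 3/4 of the cell. Rejection
may tilt the proposal towards the ends of S, but under a weight γ ≤ 1 of mass t the logarithm of the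
larger fraction still integrates to at most t log(1 - t/4) (`lintegral_mul_log_splitRatio_le`). The
loss, including the term -t log t from the change of W, is at most 4/3 (1 - t) (`tilt_loss_le`), so
the acceptance probability 1 - t pays for it.

This is recorded by the potential Φ = 4/3 + J(L)/W + log(v/W), where v ≥ P(S) and J(L) integrates
log y over the heights y between L and r. As W is the integral of P(r > y) over y > L, the last two
terms are the mean of log(y v / W) over the heights of the remaining mass. For every step after the
initial one the expectation of log(4/3) + Φ' on rejection is at most Φ
(`lintegral_nextPotential_le`), and Φ ≥ 0. Step 0, where L = 0, is estimated directly and costs the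
relative entropy in nats plus 4 log(4/3) (`lintegral_nextPotential_zero_le`). Telescoping bounds
log(4/3) times the sum of the probabilities of D ≥ d + 1, which is log(4/3) E[D]. -/

theorem log_tangent {x a : ℝ} (hx : 0 < x) (ha : 0 < a) :
    Real.log x ≤ Real.log a + (x - a) / a := by
  have h := Real.log_le_sub_one_of_pos (div_pos hx ha)
  rw [Real.log_div hx.ne' ha.ne'] at h
  have : (x - a) / a = x / a - 1 := by field_simp
  linarith

theorem log_four_thirds_eq :
    Real.log (4 / 3) = 2 * Real.log 2 - Real.log 3 := by
  rw [Real.log_div (by norm_num) (by norm_num), show (4 : ℝ) = 2 ^ 2 by norm_num, Real.log_pow]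
  norm_num

/-- The loss caused by tilting the split point towards the ends of the cell is paid for by the
acceptance probability `1 - t`. -/
theorem tilt_loss_le {t : ℝ} (h0 : 0 < t) (h1 : t ≤ 1) :
    t * (Real.log (4 / 3) + Real.log (1 - t / 4) - Real.log t) ≤ 4 / 3 * (1 - t) := by
  have e1 : Real.log (4 / 3) + Real.log (1 - t / 4) ≤ (1 - t) / 3 := by
    rw [← Real.log_mul (by norm_num) (by linarith)]
    refine (Real.log_le_sub_one_of_pos (by linarith)).trans (by linarith)
  have e2 : -(t * Real.log t) ≤ 1 - t := by
    have h := Real.log_le_sub_one_of_pos (inv_pos.2 h0)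
    rw [Real.log_inv] at h
    have := mul_le_mul_of_nonneg_left h h0.le
    rw [mul_sub, mul_inv_cancel₀ h0.ne'] at this
    linarith
  nlinarith

/-- The primitive `y log y - y` of the logarithm. -/
def logPrim (y : ℝ) : ℝ := y * Real.log y - y

/-- Convexity of `logPrim`, whose derivative is `log`; it is the tangent inequality of `log`
multiplied by `y`. -/
theorem logPrim_tangent {x y : ℝ} (hx : 0 < x) (hy : 0 < y) :
    logPrim x + Real.log x * (y - x) ≤ logPrim y := by
  have h := mul_le_mul_of_nonneg_left (log_tangent hx hy) hy.le
  rw [mul_add, mul_div_cancel₀ _ hy.ne'] at h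
  unfold logPrim
  linarith

theorem logPrim_add_mono {a b c : ℝ} (ha : 0 < a) (hab : a ≤ b) (hc : 0 ≤ Real.log a + c) :
    logPrim a + a * c ≤ logPrim b + b * c := by
  have h := logPrim_tangent ha (ha.trans_le hab)
  nlinarith

/-- The integral of `log` over `[L, q]`, or `0` if `q ≤ L`. -/
def logGap (L q : ℝ) : ℝ := logPrim (max q L) - logPrim L

theorem logGap_add_nonneg {L q c : ℝ} (hL : 0 < L) (hc : 0 ≤ Real.log L + c) :
    0 ≤ logGap L q + max (q - L) 0 * c := by
  have h := logPrim_add_mono hL (le_max_right q L) hc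
  have e : max (q - L) 0 = max q L - L := by rw [← max_sub_sub_right, sub_self]
  rw [e]
  unfold logGap
  linarith

/-- Both sides integrate `log y + c` up to `q`. The integrand is nonnegative from `a` on, so raising
the lower end from `a` to `b` discards a nonnegative part. -/
theorem logGap_add_anti {a b q c : ℝ} (ha : 0 < a) (hab : a ≤ b) (hc : 0 ≤ Real.log a + c) :
    logGap b q + max (q - b) 0 * c ≤ logGap a q + max (q - a) 0 * c := by
  rcases le_total q b with hq | hq
  · have : logGap b q + max (q - b) 0 * c = 0 := by
      simp [logGap, hq]
    rw [this]
    exact logGap_add_nonneg ha hc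
  · have h := logPrim_add_mono ha hab hc
    rw [logGap, logGap, max_eq_left hq, max_eq_left (hab.trans hq), max_eq_left (by linarith),
      max_eq_left (by linarith)]
    linarith

theorem logGap_nonneg {L q : ℝ} (hL : 1 ≤ L) : 0 ≤ logGap L q := by
  simpa using logGap_add_nonneg (q := q) (c := 0) (by linarith) (by simpa using Real.log_nonneg hL)

theorem logGap_le_klFun {L q : ℝ} (hL : 1 ≤ L) (hq : 0 ≤ q) :
    logGap L q ≤ InformationTheory.klFun q := by
  have h := logGap_add_anti (q := q) (c := 0) one_pos hL (by simp)
  simp only [mul_zero, add_zero] at h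
  refine h.trans ?_
  rcases le_total q 1 with h1 | h1
  · simpa [logGap, h1] using InformationTheory.klFun_nonneg hq
  · simp [logGap, h1, logPrim, InformationTheory.klFun]
    linarith

/-- The part of `klFun` not captured by `logGap 1`, bounded by a tangent at `1 / 3`. -/
theorem logGap_one_add_le_klFun {q : ℝ} (hq : 0 ≤ q) :
    logGap 1 q + (2 / 3 - Real.log 3 + max (1 - q) 0 * Real.log 3)
      ≤ InformationTheory.klFun q := by
  rcases le_total q 1 with h1 | h1
  · rw [max_eq_left (by linarith), logGap, max_eq_right h1, sub_self, zero_add]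
    rcases hq.eq_or_lt with rfl | h0
    · rw [InformationTheory.klFun_zero]; linarith
    · have h := logPrim_tangent (x := 1 / 3) (by norm_num) h0
      have e : Real.log (1 / 3) = - Real.log 3 := by rw [one_div, Real.log_inv]
      unfold logPrim at h
      rw [e] at h
      unfold InformationTheory.klFun
      linarith
  -- Above `1` the functions `logGap 1` and `klFun` agree, and the constant `2 / 3 - log 3` left
  -- over is not positive.
  · have h3 : 2 / 3 ≤ Real.log 3 := by
      have := Real.log_le_sub_one_of_pos (x := (3 : ℝ)⁻¹) (by norm_num)
      rw [Real.log_inv] at this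
      linarith
    rw [max_eq_right (by linarith)]
    simp only [logGap, h1, max_eq_left, logPrim, InformationTheory.klFun, Real.log_one]
    linarith

/-- The budget of step `0`, with `t` its rejection probability. Bounding `t log t` by the tangent at
`2 / 3` makes the claim linear in `t`; the constant `4` works because `(4 / 3) ^ 4 ≥ 3`. -/
theorem first_step_le {t : ℝ} (h0 : 0 < t) :
    t * (Real.log (4 / 3) + 4 / 3 - Real.log t)
      ≤ 4 * Real.log (4 / 3) + (2 / 3 - Real.log 3 + t * Real.log 3) := by
  have h2 : 1 / 3 ≤ Real.log 3 - Real.log 2 := by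
    have := Real.log_le_sub_one_of_pos (x := (2 / 3 : ℝ)) (by norm_num)
    rw [Real.log_div (by norm_num) (by norm_num)] at this
    linarith
  have h3 : Real.log 3 ≤ 4 * Real.log (4 / 3) := by
    have : Real.log 3 ≤ Real.log ((4 / 3) ^ 4) := Real.log_le_log (by norm_num) (by norm_num)
    rwa [Real.log_pow] at this
  have h4 := logPrim_tangent (x := 2 / 3) (by norm_num) h0
  unfold logPrim at h4
  rw [Real.log_div (by norm_num) (by norm_num)] at h4
  have h6 : t * (1 / 3) ≤ t * (Real.log 3 - Real.log 2) := mul_le_mul_of_nonneg_left h2 h0.le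
  rw [log_four_thirds_eq] at h3 ⊢
  linarith

/-! ### The position of a sample in an atomless law -/

/-- The larger one of the fractions of the `P`-mass of `S` on the two sides of `x`. -/
def splitRatio (P : Measure ℝ) (S : Set ℝ) (x : ℝ) : ℝ :=
  max (P.real (S ∩ Iic x)) (P.real (S ∩ Ici x)) / P.real S

/-- By inner regularity a set of mass above `z` would contain a compact `K` of mass above `z`; the
half-line ending at the maximum of `K` contains `K`, although that maximum lies in the set. Atoms do
no harm here. -/
theorem measure_lt_le_of_lower {ν : Measure ℝ} [IsProbabilityMeasure ν] (z : ℝ≥0∞)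
    (hA : MeasurableSet {x | ν (Iic x) < z}) : ν {x | ν (Iic x) < z} ≤ z := by
  by_contra! h
  obtain ⟨K, hK, hc, hz⟩ := hA.exists_lt_isCompact_of_ne_top (measure_ne_top _ _) h
  have hne : K.Nonempty := by
    rcases K.eq_empty_or_nonempty with rfl | h
    · simp at hz
    · exact h
  have hm := hc.sSup_mem hne
  have : ν K ≤ ν (Iic (sSup K)) := measure_mono fun x hx => le_csSup hc.bddAbove hx
  exact absurd (hz.trans_le this) (not_lt.2 (hK hm).le)

theorem measure_lt_le_of_upper {ν : Measure ℝ} [IsProbabilityMeasure ν] (z : ℝ≥0∞)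
    (hA : MeasurableSet {x | ν (Ici x) < z}) : ν {x | ν (Ici x) < z} ≤ z := by
  by_contra! h
  obtain ⟨K, hK, hc, hz⟩ := hA.exists_lt_isCompact_of_ne_top (measure_ne_top _ _) h
  have hne : K.Nonempty := by
    rcases K.eq_empty_or_nonempty with rfl | h
    · simp at hz
    · exact h
  have hm := hc.sInf_mem hne
  have : ν K ≤ ν (Ici (sInf K)) := measure_mono fun x hx => csInf_le hc.bddBelow hx
  exact absurd (hz.trans_le this) (not_lt.2 (hK hm).le)

theorem measurable_measure_Iic (ν : Measure ℝ) : Measurable fun x => ν (Iic x) :=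
  Monotone.measurable fun _ _ h => measure_mono (Iic_subset_Iic.2 h)

theorem measurable_measure_Ici (ν : Measure ℝ) : Measurable fun x => ν (Ici x) :=
  Antitone.measurable fun _ _ h => measure_mono (Ici_subset_Ici.2 h)

/-- A variable that is stochastically larger than a uniform one has at most the uniform mean of
`(y - ·)⁺`. -/
theorem integral_sub_pos_le {α : Type*} [MeasurableSpace α] {ν : Measure α}
    [IsProbabilityMeasure ν] {F : α → ℝ} (hF : Measurable F) (h0 : ∀ x, 0 ≤ F x)
    (hd : ∀ z, 0 ≤ z → ν {x | F x < z} ≤ ENNReal.ofReal z) {y : ℝ} (hy : 0 ≤ y) :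
    ∫ x, max (y - F x) 0 ∂ν ≤ y ^ 2 / 2 := by
  have hint : Integrable (fun x => max (y - F x) 0) ν := by
    refine Integrable.of_bound (C := y) (by fun_prop) (.of_forall fun x => ?_)
    rw [Real.norm_eq_abs, abs_of_nonneg (le_max_right _ _)]
    exact max_le (by linarith [h0 x]) hy
  have key : ∫⁻ x, ENNReal.ofReal (max (y - F x) 0) ∂ν ≤ ENNReal.ofReal (y ^ 2 / 2) := by
    rw [lintegral_eq_lintegral_meas_lt ν (f := fun x => max (y - F x) 0)
      (.of_forall fun x => le_max_right _ _) (by fun_prop)]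
    calc ∫⁻ s in Ioi (0 : ℝ), ν {a | s < max (y - F a) 0}
        ≤ ∫⁻ s in Ioi (0 : ℝ), (Ioc 0 y).indicator (fun s => ENNReal.ofReal (y - s)) s := by
          refine setLIntegral_mono ?_ fun s (hs : 0 < s) => ?_
          · exact Measurable.indicator (by fun_prop) measurableSet_Ioc
          have e : {a | s < max (y - F a) 0} = {a | F a < y - s} := by
            ext a
            simp only [mem_ofPred_eq, lt_max_iff]
            constructor
            · rintro (h | h) <;> linarith
            · intro h; left; linarith
          rw [e]
          by_cases hsy : s ≤ y
          · rw [indicator_of_mem (show s ∈ Ioc 0 y from ⟨hs, hsy⟩)]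
            exact hd _ (by linarith)
          · have : {a | F a < y - s} = ∅ := by
              ext a
              simp only [mem_ofPred_eq, mem_empty_iff_false, iff_false, not_lt]
              linarith [h0 a]
            simp [this]
      _ = ∫⁻ s in Ioc 0 y, ENNReal.ofReal (y - s) := by
          rw [lintegral_indicator measurableSet_Ioc, Measure.restrict_restrict measurableSet_Ioc,
            inter_eq_left.2 Ioc_subset_Ioi_self]
      _ = ENNReal.ofReal (∫ s in Ioc 0 y, (y - s)) := by
          rw [ofReal_integral_eq_lintegral_ofReal]
          · exact (Continuous.integrableOn_Icc (by fun_prop)).mono_set Ioc_subset_Icc_self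
          · refine (ae_restrict_iff' measurableSet_Ioc).2 (.of_forall fun s hs => ?_)
            simpa using hs.2
      _ = ENNReal.ofReal (y ^ 2 / 2) := by
          rw [← intervalIntegral.integral_of_le hy, intervalIntegral.integral_sub (by simp)
            (by simp)]
          simp
          ring_nf
  rw [← ofReal_integral_eq_lintegral_ofReal hint (.of_forall fun x => le_max_right _ _)] at key
  exact (ENNReal.ofReal_le_ofReal_iff (by positivity)).1 key

/-- Under an atomless law the distance of a sample to the nearer end, in units of mass, has mean at
least `t ^ 2 / 4` under every weight `γ ≤ 1` of total mass `t`. -/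
theorem sq_le_integral_mul_min {ν : Measure ℝ} [IsProbabilityMeasure ν] [NullSingletonClass ν]
    {γ : ℝ → ℝ} (hγ : Measurable γ) (h0 : ∀ x, 0 ≤ γ x) (h1 : ∀ x, γ x ≤ 1) :
    (∫ x, γ x ∂ν) ^ 2 / 4 ≤ ∫ x, γ x * (1 - splitRatio ν univ x) ∂ν := by
  set t := ∫ x, γ x ∂ν with ht
  have ht0 : 0 ≤ t := integral_nonneg h0
  have hm1 : Measurable fun x => ν.real (Iic x) := (measurable_measure_Iic ν).ennreal_toReal
  have hm2 : Measurable fun x => ν.real (Ici x) := (measurable_measure_Ici ν).ennreal_toReal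
  have hsum (x : ℝ) : ν.real (Iic x) + ν.real (Ici x) = 1 := by
    have : ν.real (Ici x) = ν.real (Ioi x) := by
      rw [measureReal_def, measureReal_def, measure_congr Ioi_ae_eq_Ici]
    rw [this, ← compl_Iic, measureReal_add_measureReal_compl measurableSet_Iic]
    simp
  have hr (x : ℝ) : 1 - splitRatio ν univ x = min (ν.real (Iic x)) (ν.real (Ici x)) := by
    have := hsum x
    simp only [splitRatio, univ_inter, probReal_univ, div_one]
    rcases le_total (ν.real (Iic x)) (ν.real (Ici x)) with h | h
    · rw [max_eq_right h, min_eq_left h]; linarith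
    · rw [max_eq_left h, min_eq_right h]; linarith
  have hb {f : ℝ → ℝ} (hf : Measurable f) (h0 : ∀ x, 0 ≤ f x) {C : ℝ} (h1 : ∀ x, f x ≤ C) :
      Integrable f ν :=
    Integrable.of_bound (C := C) hf.aestronglyMeasurable (.of_forall fun x => by
      rw [Real.norm_eq_abs, abs_of_nonneg (h0 x)]; exact h1 x)
  have d1 : ∫ x, max (t / 2 - ν.real (Iic x)) 0 ∂ν ≤ (t / 2) ^ 2 / 2 := by
    refine integral_sub_pos_le hm1 (fun _ => measureReal_nonneg) (fun z hz => ?_) (by linarith)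
    have e : {x | ν.real (Iic x) < z} = {x | ν (Iic x) < ENNReal.ofReal z} := by
      ext x
      simp [measureReal_def, ENNReal.lt_ofReal_iff_toReal_lt]
    rw [e]
    exact measure_lt_le_of_lower _ (measurableSet_lt (measurable_measure_Iic ν) measurable_const)
  have d2 : ∫ x, max (t / 2 - ν.real (Ici x)) 0 ∂ν ≤ (t / 2) ^ 2 / 2 := by
    refine integral_sub_pos_le hm2 (fun _ => measureReal_nonneg) (fun z hz => ?_) (by linarith)
    have e : {x | ν.real (Ici x) < z} = {x | ν (Ici x) < ENNReal.ofReal z} := by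
      ext x
      simp [measureReal_def, ENNReal.lt_ofReal_iff_toReal_lt]
    rw [e]
    exact measure_lt_le_of_upper _ (measurableSet_lt (measurable_measure_Ici ν) measurable_const)
  have i1 : Integrable (fun x => max (t / 2 - ν.real (Iic x)) 0) ν :=
    hb (by fun_prop) (fun _ => le_max_right _ _) (C := t / 2) fun x =>
      max_le (by linarith [measureReal_nonneg (μ := ν) (s := Iic x)]) (by linarith)
  have i2 : Integrable (fun x => max (t / 2 - ν.real (Ici x)) 0) ν :=
    hb (by fun_prop) (fun _ => le_max_right _ _) (C := t / 2) fun x =>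
      max_le (by linarith [measureReal_nonneg (μ := ν) (s := Ici x)]) (by linarith)
  have i12 : Integrable (fun x => max (t / 2 - ν.real (Iic x)) 0
      + max (t / 2 - ν.real (Ici x)) 0) ν := i1.add i2
  have iγ : Integrable γ ν := hb hγ h0 h1
  have iγm : Integrable (fun x => γ x * min (ν.real (Iic x)) (ν.real (Ici x))) ν := by
    refine hb (by fun_prop)
      (fun x => mul_nonneg (h0 x) (le_min measureReal_nonneg measureReal_nonneg)) (C := 1)
      fun x => mul_le_one₀ (h1 x) (le_min measureReal_nonneg measureReal_nonneg)
        ((min_le_left _ _).trans measureReal_le_one)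
  simp_rw [hr]
  -- Pointwise, since `0 ≤ γ ≤ 1`: lowering the minimum below `t / 2` costs at most the two positive
  -- parts. Integrated, the left side is at least `t ^ 2 / 2 - 2 * (t ^ 2 / 8) = t ^ 2 / 4`. The
  -- extremal `γ` lives on the two end pieces of mass `t / 2`.
  have hle : ∫ x, (t / 2 * γ x - (max (t / 2 - ν.real (Iic x)) 0
      + max (t / 2 - ν.real (Ici x)) 0)) ∂ν
      ≤ ∫ x, γ x * min (ν.real (Iic x)) (ν.real (Ici x)) ∂ν := by
    refine integral_mono ((iγ.const_mul _).sub i12) iγm fun x => ?_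
    have a1 := le_max_left (t / 2 - ν.real (Iic x)) 0
    have a2 := le_max_right (t / 2 - ν.real (Iic x)) 0
    have a3 := le_max_left (t / 2 - ν.real (Ici x)) 0
    have a4 := le_max_right (t / 2 - ν.real (Ici x)) 0
    have b0 := h0 x
    have b1 := h1 x
    simp only
    rcases min_choice (ν.real (Iic x)) (ν.real (Ici x)) with h | h <;> rw [h] <;> nlinarith
  rw [integral_sub (iγ.const_mul _) i12, integral_const_mul, ← ht] at hle
  have e : ∫ x, (max (t / 2 - ν.real (Iic x)) 0 + max (t / 2 - ν.real (Ici x)) 0) ∂ν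
      = ∫ x, max (t / 2 - ν.real (Iic x)) 0 ∂ν + ∫ x, max (t / 2 - ν.real (Ici x)) 0 ∂ν :=
    integral_add i1 i2
  nlinarith

theorem half_le_splitRatio_univ {ν : Measure ℝ} [IsProbabilityMeasure ν] (x : ℝ) :
    1 / 2 ≤ splitRatio ν univ x := by
  have : 1 ≤ ν.real (Iic x) + ν.real (Ici x) := by
    have := measureReal_union_le (μ := ν) (Iic x) (Ici x)
    rw [Iic_union_Ici] at this
    simpa using this
  simp only [splitRatio, univ_inter, probReal_univ, div_one]
  rcases le_total (ν.real (Iic x)) (ν.real (Ici x)) with h | h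
  · rw [max_eq_right h]; linarith
  · rw [max_eq_left h]; linarith

theorem splitRatio_univ_le {ν : Measure ℝ} [IsProbabilityMeasure ν] (x : ℝ) :
    splitRatio ν univ x ≤ 1 := by
  simp only [splitRatio, univ_inter, probReal_univ, div_one]
  exact max_le measureReal_le_one measureReal_le_one

theorem measurable_splitRatio_univ (ν : Measure ℝ) : Measurable (splitRatio ν univ) := by
  have hm1 : Measurable fun x => ν.real (Iic x) := (measurable_measure_Iic ν).ennreal_toReal
  have hm2 : Measurable fun x => ν.real (Ici x) := (measurable_measure_Ici ν).ennreal_toReal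
  unfold splitRatio
  simp only [univ_inter]
  fun_prop

/-- The mean logarithm of the split ratio under a weight `γ ≤ 1` of total mass `t`. -/
theorem lintegral_mul_log_splitRatio_le {ν : Measure ℝ} [IsProbabilityMeasure ν]
    [NullSingletonClass ν] {γ : ℝ → ℝ} (hγ : Measurable γ) (h0 : ∀ x, 0 ≤ γ x)
    (h1 : ∀ x, γ x ≤ 1) (c : ℝ) (hc : Real.log 2 ≤ c) {t : ℝ} (ht : t = ∫ x, γ x ∂ν) :
    ∫⁻ x, ENNReal.ofReal (γ x) * ENNReal.ofReal (c + Real.log (splitRatio ν univ x)) ∂ν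
      ≤ ENNReal.ofReal (t * (c + Real.log (1 - t / 4))) := by
  have hb {f : ℝ → ℝ} (hf : Measurable f) (h0 : ∀ x, 0 ≤ f x) {C : ℝ} (h1 : ∀ x, f x ≤ C) :
      Integrable f ν :=
    Integrable.of_bound (C := C) hf.aestronglyMeasurable (.of_forall fun x => by
      rw [Real.norm_eq_abs, abs_of_nonneg (h0 x)]; exact h1 x)
  have hms := measurable_splitRatio_univ ν
  have iγ : Integrable γ ν := hb hγ h0 h1
  have ht0 : 0 ≤ t := ht ▸ integral_nonneg h0
  have ht1 : t ≤ 1 := by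
    rw [ht]
    calc ∫ x, γ x ∂ν ≤ ∫ x, (1 : ℝ) ∂ν := integral_mono iγ (integrable_const _) h1
      _ = 1 := by simp
  set a := 1 - t / 4 with ha
  have ha0 : 0 < a := by linarith
  have iγs : Integrable (fun x => γ x * (1 - splitRatio ν univ x)) ν :=
    hb (by fun_prop) (fun x => mul_nonneg (h0 x) (by linarith [splitRatio_univ_le (ν := ν) x]))
      (C := 1) fun x => mul_le_one₀ (h1 x) (by linarith [splitRatio_univ_le (ν := ν) x])
        (by linarith [half_le_splitRatio_univ (ν := ν) x])
  have hsq := sq_le_integral_mul_min (ν := ν) hγ h0 h1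
  rw [← ht] at hsq
  have hpt (x : ℝ) : c + Real.log (splitRatio ν univ x)
      ≤ (c + Real.log a + (1 - a) / a) - 1 / a * (1 - splitRatio ν univ x) := by
    have := log_tangent (x := splitRatio ν univ x) (a := a)
      (by linarith [half_le_splitRatio_univ (ν := ν) x]) ha0
    have e : (1 - a) / a - 1 / a * (1 - splitRatio ν univ x) = (splitRatio ν univ x - a) / a := by
      field_simp; ring
    linarith
  -- The ratio is at least `1 / 2`, so `c ≥ log 2` is what keeps `ENNReal.ofReal` from truncating.
  have hpos (x : ℝ) : 0 ≤ c + Real.log (splitRatio ν univ x) := by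
    have := Real.log_le_log (by norm_num) (half_le_splitRatio_univ (ν := ν) x)
    rw [one_div, Real.log_inv] at this
    linarith
  calc ∫⁻ x, ENNReal.ofReal (γ x) * ENNReal.ofReal (c + Real.log (splitRatio ν univ x)) ∂ν
      ≤ ∫⁻ x, ENNReal.ofReal ((c + Real.log a + (1 - a) / a) * γ x
          - 1 / a * (γ x * (1 - splitRatio ν univ x))) ∂ν := by
        refine lintegral_mono fun x => ?_
        rw [← ENNReal.ofReal_mul (h0 x)]
        refine ENNReal.ofReal_le_ofReal ?_
        have := mul_le_mul_of_nonneg_left (hpt x) (h0 x)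
        linarith
    _ = ENNReal.ofReal (∫ x, ((c + Real.log a + (1 - a) / a) * γ x
          - 1 / a * (γ x * (1 - splitRatio ν univ x))) ∂ν) := by
        refine (ofReal_integral_eq_lintegral_ofReal
          ((iγ.const_mul _).sub (iγs.const_mul _)) ?_).symm
        refine .of_forall fun x => ?_
        have := mul_le_mul_of_nonneg_left (hpt x) (h0 x)
        have := mul_nonneg (h0 x) (hpos x)
        simp only [Pi.zero_apply, Pi.sub_apply]
        linarith
    _ ≤ _ := by
        refine ENNReal.ofReal_le_ofReal ?_
        rw [integral_sub (iγ.const_mul _) (iγs.const_mul _), integral_const_mul,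
          integral_const_mul, ← ht]
        have h2 : 1 / a * (t ^ 2 / 4) ≤ 1 / a * ∫ x, γ x * (1 - splitRatio ν univ x) ∂ν :=
          mul_le_mul_of_nonneg_left hsq (by positivity)
        -- The tangent point `a = 1 - t / 4` is chosen so that the linear terms of the tangent
        -- cancel against the bound `t ^ 2 / 4`.
        have e : (1 - a) / a * t = 1 / a * (t ^ 2 / 4) := by rw [ha]; ring
        nlinarith

/-! ### A single branch of the sample-splitting process -/

/-- A sequence of draws `(x, u)` and coin tosses. -/
abbrev Hist := ℕ → (ℝ × ℝ) × Bool

/-- The active sets along a history. -/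
def cell (g : Hist) : ℕ → Set ℝ
  | 0 => univ
  | d + 1 => cell g d ∩ if (g d).2 then Ici (g d).1.1 else Iic (g d).1.1

/-- The real-valued density ratio. -/
def dens (Q P : Measure ℝ) (x : ℝ) : ℝ := (Q.rnDeriv P x).toReal

/-- The target mass on `S` above the level `L` of the density ratio. -/
def excess (Q P : Measure ℝ) (S : Set ℝ) (L : ℝ) : ℝ := ∫ x in S, max (dens Q P x - L) 0 ∂P

/-- The level up to which the density ratio is ruled out on the active set before step `d`. -/
def level (Q P : Measure ℝ) (g : Hist) : ℕ → ℝ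
  | 0 => 0
  | d + 1 => level Q P g d + excess Q P (cell g d) (level Q P g d) / P.real (cell g d)

/-- An upper bound for the mass of the active set, which the first split does not shrink and every
other split shrinks by the larger one of the two fractions of the split. -/
def virt (P : Measure ℝ) (g : Hist) : ℕ → ℝ
  | 0 => 1
  | d + 1 => virt P g d * if d = 0 then 1 else splitRatio P (cell g d) (g d).1.1

theorem measurableSet_cell (g : Hist) (d : ℕ) : MeasurableSet (cell g d) := by
  induction d with
  | zero => exact .univ
  | succ d ih =>
    refine ih.inter ?_
    split_ifs
    exacts [measurableSet_Ici, measurableSet_Iic]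

theorem cell_succ_subset (g : Hist) (d : ℕ) : cell g (d + 1) ⊆ cell g d := inter_subset_left

theorem measurable_dens (Q P : Measure ℝ) : Measurable (dens Q P) :=
  (Measure.measurable_rnDeriv Q P).ennreal_toReal

theorem dens_nonneg (Q P : Measure ℝ) (x : ℝ) : 0 ≤ dens Q P x := ENNReal.toReal_nonneg

/-! ### Closed form of the recursion: a single level describes the ruled out mass on the active set.
-/

section

variable (Q P : Measure ℝ) [IsProbabilityMeasure Q] [IsProbabilityMeasure P]

theorem rnDeriv_ae_eq_ofReal_dens : ∀ᵐ x ∂P, Q.rnDeriv P x = ENNReal.ofReal (dens Q P x) := by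
  filter_upwards [Measure.rnDeriv_lt_top Q P] with x hx
  exact (ENNReal.ofReal_toReal hx.ne).symm

theorem integrable_dens : Integrable (dens Q P) P := Measure.integrable_toReal_rnDeriv

theorem integrable_excess (L : ℝ) : Integrable (fun x => max (dens Q P x - L) 0) P :=
  ((integrable_dens Q P).sub (integrable_const L)).pos_part

theorem excess_nonneg (S : Set ℝ) (L : ℝ) : 0 ≤ excess Q P S L :=
  integral_nonneg fun _ => le_max_right _ _

theorem excess_anti (S : Set ℝ) {L L' : ℝ} (h : L ≤ L') : excess Q P S L' ≤ excess Q P S L := by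
  refine integral_mono (integrable_excess Q P L').integrableOn (integrable_excess Q P L).integrableOn
    fun x => ?_
  exact max_le_max (by linarith) le_rfl

theorem excess_eq_univ {S : Set ℝ} {L : ℝ} (hS : ∀ᵐ x ∂P, L < dens Q P x → x ∈ S) :
    excess Q P S L = excess Q P univ L := by
  unfold excess
  rw [setIntegral_univ]
  refine setIntegral_eq_integral_of_ae_compl_eq_zero ?_
  filter_upwards [hS] with x hx hxS
  exact max_eq_right (by linarith [not_lt.1 (mt hx hxS)])

theorem level_nonneg (g : Hist) (d : ℕ) : 0 ≤ level Q P g d := by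
  induction d with
  | zero => exact le_rfl
  | succ d ih => exact add_nonneg ih (div_nonneg (excess_nonneg Q P _ _) measureReal_nonneg)

theorem level_le_succ (g : Hist) (d : ℕ) : level Q P g d ≤ level Q P g (d + 1) :=
  le_add_of_nonneg_right (div_nonneg (excess_nonneg Q P _ _) measureReal_nonneg)

theorem ofReal_excess_eq_lintegral (S : Set ℝ) {L : ℝ} (hL : 0 ≤ L) :
    ENNReal.ofReal (excess Q P S L) = ∫⁻ x in S, (Q.rnDeriv P x - ENNReal.ofReal L) ∂P := by
  unfold excess
  rw [ofReal_integral_eq_lintegral_ofReal (integrable_excess Q P L).integrableOn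
    (.of_forall fun x => le_max_right _ _)]
  refine lintegral_congr_ae ?_
  filter_upwards [ae_restrict_of_ae (rnDeriv_ae_eq_ofReal_dens Q P)] with x hx
  rw [hx, ← ENNReal.ofReal_sub _ hL]
  rcases le_total (dens Q P x - L) 0 with h | h
  · rw [max_eq_right h, ENNReal.ofReal_of_nonpos h, ENNReal.ofReal_zero]
  · rw [max_eq_left h]

variable {Q P}

open Classical in
-- The form of the density is a hypothesis so that the induction in `ruledOutDensity_cell` can call
-- on the remaining mass of the current step.
theorem one_sub_ruledOut_of_density (hQP : Q ≪ P) {g : Hist} {d : ℕ}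
    (h : ∀ x, ruledOutDensity Q P (cell g) d x =
      if x ∈ cell g d then min (Q.rnDeriv P x) (ENNReal.ofReal (level Q P g d))
      else Q.rnDeriv P x) :
    1 - ruledOut Q P (cell g) d univ =
      ENNReal.ofReal (excess Q P (cell g d) (level Q P g d)) := by
  have hm := measurable_ruledOutDensity Q P (measurableSet_cell g) d
  have hT : ruledOut Q P (cell g) d univ = ∫⁻ x, ruledOutDensity Q P (cell g) d x ∂P := by
    rw [ruledOut, withDensity_apply _ .univ, setLIntegral_univ]
  have hQ : ∫⁻ x, Q.rnDeriv P x ∂P = 1 := by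
    rw [Measure.lintegral_rnDeriv hQP]; simp
  have hle : ∀ x, ruledOutDensity Q P (cell g) d x ≤ Q.rnDeriv P x := fun x => by
    rw [h]; split_ifs; exacts [min_le_left _ _, le_rfl]
  have hsub : ∫⁻ x, (Q.rnDeriv P x - ruledOutDensity Q P (cell g) d x) ∂P
      = ENNReal.ofReal (excess Q P (cell g d) (level Q P g d)) := by
    rw [ofReal_excess_eq_lintegral Q P _ (level_nonneg Q P g d),
      ← lintegral_indicator (measurableSet_cell g d)]
    refine lintegral_congr_ae ?_
    filter_upwards [Measure.rnDeriv_lt_top Q P] with x hx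
    rw [h, indicator_apply]
    split_ifs
    · rcases le_total (Q.rnDeriv P x) (ENNReal.ofReal (level Q P g d)) with h1 | h1
      · rw [min_eq_left h1, tsub_self, tsub_eq_zero_of_le h1]
      · rw [min_eq_right h1]
    · exact tsub_self _
  have hadd : ruledOut Q P (cell g) d univ
      + ENNReal.ofReal (excess Q P (cell g d) (level Q P g d)) = 1 := by
    rw [← hsub, hT, ← lintegral_add_left hm, ← hQ]
    exact lintegral_congr fun x => add_tsub_cancel_of_le (hle x)
  rw [← hadd]
  refine ENNReal.add_sub_cancel_left ?_
  intro htop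
  rw [htop, top_add] at hadd
  exact ENNReal.top_ne_one hadd

theorem ofReal_excess_div (S : Set ℝ) (L : ℝ) :
    ENNReal.ofReal (excess Q P S L) / P S = ENNReal.ofReal (excess Q P S L / P.real S) := by
  -- On a null set the excess vanishes and both quotients are `0`.
  rcases eq_or_ne (P S) 0 with h | h
  · have : excess Q P S L = 0 := by
      unfold excess
      rw [Measure.restrict_eq_zero.2 h, integral_zero_measure]
    simp [this]
  · rw [measureReal_def, ENNReal.ofReal_div_of_pos (ENNReal.toReal_pos h (measure_ne_top _ _)),
      ENNReal.ofReal_toReal (measure_ne_top _ _)]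

open Classical in
-- On the cell, adding `min (r - L) (W / P S)` to `min r L` gives `min r (L + W / P S)`, so
-- truncation at a level is preserved. No unimodality is needed, and every history is allowed.
theorem ruledOutDensity_cell (hQP : Q ≪ P) (g : Hist) (d : ℕ) (x : ℝ) :
    ruledOutDensity Q P (cell g) d x =
      if x ∈ cell g d then min (Q.rnDeriv P x) (ENNReal.ofReal (level Q P g d))
      else Q.rnDeriv P x := by
  induction d generalizing x with
  | zero => simp [ruledOutDensity, cell, level]
  | succ d ih =>
    have h1 := one_sub_ruledOut_of_density hQP ih
    rw [ruledOutDensity]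
    beta_reduce
    by_cases hx : x ∈ cell g (d + 1)
    · rw [if_pos hx, if_pos hx, acceptDensity, ← ruledOut, h1, ofReal_excess_div, ih,
        if_pos (cell_succ_subset g d hx), level, ENNReal.ofReal_add (level_nonneg Q P g d)
          (div_nonneg (excess_nonneg Q P _ _) measureReal_nonneg)]
      rcases le_or_gt (Q.rnDeriv P x) (ENNReal.ofReal (level Q P g d)) with h2 | h2
      · rw [min_eq_left h2, tsub_self, min_eq_left zero_le, add_zero,
          min_eq_left (h2.trans le_self_add)]
      · rw [min_eq_right h2.le, ← min_add_add_left, add_tsub_cancel_of_le h2.le]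
    · rw [if_neg hx, if_neg hx]

theorem one_sub_ruledOut_cell (hQP : Q ≪ P) (g : Hist) (d : ℕ) :
    1 - ruledOut Q P (cell g) d univ =
      ENNReal.ofReal (excess Q P (cell g d) (level Q P g d)) :=
  one_sub_ruledOut_of_density hQP (ruledOutDensity_cell hQP g d)

/-- On the active set, the mass ruled out together with the mass accepted in step `d`. -/
theorem ruledOutDensity_add_alpha (hQP : Q ≪ P) (g : Hist) (d : ℕ) {x : ℝ} (hx : x ∈ cell g d) :
    ruledOutDensity Q P (cell g) d x + alpha Q P (cell g) d x
      = min (Q.rnDeriv P x) (ENNReal.ofReal (level Q P g (d + 1))) := by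
  rw [alpha, acceptDensity, ← ruledOut, one_sub_ruledOut_cell hQP, ofReal_excess_div,
    ruledOutDensity_cell hQP, if_pos hx, level, ENNReal.ofReal_add (level_nonneg Q P g d)
      (div_nonneg (excess_nonneg Q P _ _) measureReal_nonneg)]
  rcases le_or_gt (Q.rnDeriv P x) (ENNReal.ofReal (level Q P g d)) with h2 | h2
  · rw [min_eq_left h2, tsub_self, min_eq_left zero_le, add_zero,
      min_eq_left (h2.trans le_self_add)]
  · rw [min_eq_right h2.le, ← min_add_add_left, add_tsub_cancel_of_le h2.le]

/-- The probability with which a proposal `x` in `S` is rejected when the levels below `L` have been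
ruled out. -/
def rejectWeight (Q P : Measure ℝ) (S : Set ℝ) (L x : ℝ) : ℝ :=
  1 - (max (dens Q P x - L) 0 - max (dens Q P x - (L + excess Q P S L / P.real S)) 0)
    * (P.real S / excess Q P S L)

theorem measurable_rejectWeight (S : Set ℝ) (L : ℝ) : Measurable (rejectWeight Q P S L) := by
  have := measurable_dens Q P
  unfold rejectWeight
  fun_prop

theorem rejectWeight_mem {S : Set ℝ} {L : ℝ} (hs : 0 < P.real S) (hw : 0 < excess Q P S L)
    (x : ℝ) : rejectWeight Q P S L x ∈ Icc 0 1 := by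
  have hΔ : 0 < excess Q P S L / P.real S := div_pos hw hs
  have e : P.real S / excess Q P S L = (excess Q P S L / P.real S)⁻¹ := by rw [inv_div]
  have h1 : 0 ≤ max (dens Q P x - L) 0 - max (dens Q P x - (L + excess Q P S L / P.real S)) 0 := by
    rw [sub_nonneg]
    exact max_le_max (by linarith) le_rfl
  have h2 : max (dens Q P x - L) 0 - max (dens Q P x - (L + excess Q P S L / P.real S)) 0
      ≤ excess Q P S L / P.real S := by
    have := le_max_left (dens Q P x - (L + excess Q P S L / P.real S)) 0
    have := le_max_right (dens Q P x - (L + excess Q P S L / P.real S)) 0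
    rw [sub_le_iff_le_add]
    exact max_le (by linarith) (by linarith)
  unfold rejectWeight
  rw [e, ← div_eq_mul_inv]
  constructor
  · rw [sub_nonneg, div_le_one hΔ]; exact h2
  · rw [sub_le_self_iff]; positivity

/-- The layer of the density between the two levels has mass equal to the difference of the
excesses; the normalisation of the conditional law cancels the factor `P.real S`. -/
theorem integral_rejectWeight {S : Set ℝ} {L : ℝ} (hs : 0 < P.real S)
    (hw : 0 < excess Q P S L) :
    ∫ x, rejectWeight Q P S L x ∂(ProbabilityTheory.cond P S)
      = excess Q P S (L + excess Q P S L / P.real S) / excess Q P S L := by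
  have hi := (integrable_excess Q P L).integrableOn (s := S)
  have hi' := (integrable_excess Q P (L + excess Q P S L / P.real S)).integrableOn (s := S)
  have hd : IntegrableOn (fun x => max (dens Q P x - L) 0
      - max (dens Q P x - (L + excess Q P S L / P.real S)) 0) S P := hi.sub hi'
  rw [ProbabilityTheory.cond, integral_smul_measure]
  unfold rejectWeight
  rw [integral_sub (integrable_const _) (hd.mul_const _), integral_mul_const,
    integral_sub hi hi', ← excess, ← excess]
  simp only [integral_const, ENNReal.toReal_inv, smul_eq_mul, mul_one, measureReal_restrict_apply_univ]
  rw [← measureReal_def]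
  field_simp
  ring

theorem volume_reject (b : ℝ≥0∞) :
    volume.restrict (Icc (0 : ℝ) 1) {u | ¬ ENNReal.ofReal u ≤ b} = 1 - b := by
  have hm : MeasurableSet {u : ℝ | ¬ ENNReal.ofReal u ≤ b} :=
    (measurableSet_le ENNReal.measurable_ofReal measurable_const).compl
  rw [Measure.restrict_apply hm]
  rcases le_or_gt 1 b with h | h
  · rw [tsub_eq_zero_of_le h]
    have : {u : ℝ | ¬ ENNReal.ofReal u ≤ b} ∩ Icc 0 1 = ∅ := by
      ext u
      simp only [mem_inter_iff, mem_ofPred_eq, mem_Icc, mem_empty_iff_false, iff_false]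
      rintro ⟨h1, h2⟩
      exact h1 ((ENNReal.ofReal_le_one.2 h2.2).trans h)
    rw [this, measure_empty]
  · have hb : b ≠ ∞ := (h.trans ENNReal.one_lt_top).ne
    have : {u : ℝ | ¬ ENNReal.ofReal u ≤ b} ∩ Icc 0 1 = Ioc b.toReal 1 := by
      ext u
      simp only [mem_inter_iff, mem_ofPred_eq, mem_Icc, mem_Ioc, ENNReal.ofReal_le_iff_le_toReal hb,
        not_le]
      constructor
      · rintro ⟨h1, h2⟩; exact ⟨h1, h2.2⟩
      · rintro ⟨h1, h2⟩; exact ⟨h1, ENNReal.toReal_nonneg.trans h1.le, h2⟩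
    rw [this, Real.volume_Ioc, ENNReal.ofReal_sub _ ENNReal.toReal_nonneg, ENNReal.ofReal_toReal hb,
      ENNReal.ofReal_one]

theorem measurable_acceptProb_cell (g : Hist) (d : ℕ) :
    Measurable (acceptProb Q P (cell g) d) := by
  have := measurable_ruledOutDensity Q P (measurableSet_cell g) d
  exact ((((Measure.measurable_rnDeriv Q P).sub this).min measurable_const)).mul_const _

theorem one_sub_acceptProb (hQP : Q ≪ P) {g : Hist} {d : ℕ} (hs : 0 < P.real (cell g d))
    (hw : 0 < excess Q P (cell g d) (level Q P g d)) :
    ∀ᵐ x ∂(ProbabilityTheory.cond P (cell g d)), 1 - acceptProb Q P (cell g) d x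
      = ENNReal.ofReal (rejectWeight Q P (cell g d) (level Q P g d) x) := by
  filter_upwards [ProbabilityTheory.ae_cond_mem (measurableSet_cell g d),
    ProbabilityTheory.cond_absolutelyContinuous.ae_le (rnDeriv_ae_eq_ofReal_dens Q P)] with x hx hq
  have h0 := level_nonneg Q P g d
  have hd := dens_nonneg Q P x
  have hmem := rejectWeight_mem (Q := Q) hs hw x
  set L := level Q P g d with hL
  set w := excess Q P (cell g d) L with hwd
  set s := P.real (cell g d) with hsd
  have hΔ : 0 < w / s := div_pos hw hs
  have e1 : alpha Q P (cell g) d x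
      = ENNReal.ofReal (max (dens Q P x - L) 0 - max (dens Q P x - (L + w / s)) 0) := by
    rw [alpha, acceptDensity, ← ruledOut, one_sub_ruledOut_cell hQP, ofReal_excess_div,
      ruledOutDensity_cell hQP, if_pos hx, hq, ← hL, ← hwd, ← hsd, ← ENNReal.ofReal_min,
      ← ENNReal.ofReal_sub _ (le_min hd h0), ← ENNReal.ofReal_min]
    congr 1
    rcases le_total (dens Q P x) L with h1 | h1
    · rw [min_eq_left h1, sub_self, min_eq_left hΔ.le, max_eq_right (by linarith),
        max_eq_right (by linarith), sub_zero]
    · rw [min_eq_right h1, max_eq_left (by linarith)]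
      rcases le_total (dens Q P x) (L + w / s) with h2 | h2
      · rw [min_eq_left (by linarith), max_eq_right (by linarith), sub_zero]
      · rw [min_eq_right (by linarith), max_eq_left (by linarith)]
        ring
  have e2 : P (cell g d) / (1 - ruledOut Q P (cell g) d univ) = ENNReal.ofReal (s / w) := by
    rw [one_sub_ruledOut_cell hQP, ← hL, ← hwd, ENNReal.ofReal_div_of_pos hw, hsd,
      measureReal_def, ENNReal.ofReal_toReal (measure_ne_top _ _)]
  have hnn : 0 ≤ max (dens Q P x - L) 0 - max (dens Q P x - (L + w / s)) 0 :=
    sub_nonneg.2 (max_le_max (by linarith) le_rfl)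
  rw [acceptProb, e1, e2, ← ENNReal.ofReal_mul hnn, ← ENNReal.ofReal_one,
    ← ENNReal.ofReal_sub _ (mul_nonneg hnn (div_nonneg hs.le hw.le))]
  rfl

/-- The law of a draw and of the uniform variable at the active set. -/
def drawLaw (P : Measure ℝ) (S : Set ℝ) : Measure (ℝ × ℝ) :=
  (ProbabilityTheory.cond P S).prod (volume.restrict (Icc (0 : ℝ) 1))

/-- Averaging over the uniform variable: `f` integrated over the rejected proposals. -/
theorem lintegral_drawLaw_reject (hQP : Q ≪ P) {g : Hist} {d : ℕ} (hs : 0 < P.real (cell g d))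
    (hw : 0 < excess Q P (cell g d) (level Q P g d)) {f : ℝ → ℝ≥0∞} (hf : Measurable f) :
    ∫⁻ y, {y : ℝ × ℝ | ¬ ENNReal.ofReal y.2 ≤ acceptProb Q P (cell g) d y.1}.indicator
        (fun y => f y.1) y ∂(drawLaw P (cell g d))
      = ∫⁻ x, ENNReal.ofReal (rejectWeight Q P (cell g d) (level Q P g d) x) * f x
          ∂(ProbabilityTheory.cond P (cell g d)) := by
  have ha := measurable_acceptProb_cell (Q := Q) (P := P) g d
  have hset : MeasurableSet {y : ℝ × ℝ | ¬ ENNReal.ofReal y.2 ≤ acceptProb Q P (cell g) d y.1} :=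
    (measurableSet_le (ENNReal.measurable_ofReal.comp measurable_snd) (ha.comp measurable_fst)).compl
  rw [drawLaw, lintegral_prod _ (by exact ((hf.comp measurable_fst).indicator hset).aemeasurable)]
  refine lintegral_congr_ae ?_
  filter_upwards [one_sub_acceptProb hQP hs hw] with x hx
  rw [← hx, ← volume_reject]
  have hm : MeasurableSet {u : ℝ | ¬ ENNReal.ofReal u ≤ acceptProb Q P (cell g) d x} :=
    (measurableSet_le ENNReal.measurable_ofReal measurable_const).compl
  rw [mul_comm, ← lintegral_indicator_const hm]
  rfl

end

/-! ### The branch probability under a unimodal density ratio -/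

section

variable {Q P : Measure ℝ} [IsProbabilityMeasure Q] [IsProbabilityMeasure P]

/-- On the cell, ruled out and accepted mass together have density `min r L'` with `L'` the next
level, so what is left on a subset is its excess over `L'`. -/
theorem remaining_mass_eq (hQP : Q ≪ P) (g : Hist) (d : ℕ) {R : Set ℝ} (hR : MeasurableSet R)
    (hsub : R ⊆ cell g d) :
    Q R - ruledOut Q P (cell g) d R - accepted Q P (cell g) d R
      = ENNReal.ofReal (excess Q P R (level Q P g (d + 1))) := by
  have hm := measurable_ruledOutDensity Q P (measurableSet_cell g) d
  have hadd : ruledOut Q P (cell g) d R + accepted Q P (cell g) d R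
      = ∫⁻ x in R, min (Q.rnDeriv P x) (ENNReal.ofReal (level Q P g (d + 1))) ∂P := by
    rw [ruledOut, accepted, withDensity_apply _ hR, withDensity_apply _ hR, ← lintegral_add_left hm]
    exact setLIntegral_congr_fun hR fun x hx => ruledOutDensity_add_alpha hQP g d (hsub hx)
  have hQ : Q R = ∫⁻ x in R, min (Q.rnDeriv P x) (ENNReal.ofReal (level Q P g (d + 1))) ∂P
      + ENNReal.ofReal (excess Q P R (level Q P g (d + 1))) := by
    rw [ofReal_excess_eq_lintegral Q P _ (level_nonneg Q P g _), ← lintegral_add_left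
      ((Measure.measurable_rnDeriv Q P).min measurable_const), ← Measure.setLIntegral_rnDeriv hQP]
    refine lintegral_congr fun x => ?_
    rcases le_total (Q.rnDeriv P x) (ENNReal.ofReal (level Q P g (d + 1))) with h | h
    · rw [min_eq_left h, tsub_eq_zero_of_le h, add_zero]
    · rw [min_eq_right h, add_tsub_cancel_of_le h]
  rw [tsub_tsub, hadd, hQ]
  refine ENNReal.add_sub_cancel_left fun htop => ?_
  rw [htop, top_add] at hQ
  exact measure_ne_top Q R hQ

theorem branchProb_eq (hQP : Q ≪ P) (g : Hist) (d : ℕ) {R : Set ℝ} (hR : MeasurableSet R)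
    (hsub : R ⊆ cell g d) :
    branchProb Q P (cell g) d R = ENNReal.ofReal (excess Q P R (level Q P g (d + 1)))
      / ENNReal.ofReal (excess Q P (cell g d) (level Q P g (d + 1))) := by
  rw [branchProb, remaining_mass_eq hQP g d hR hsub,
    remaining_mass_eq hQP g d (measurableSet_cell g d) subset_rfl]

/-- Up to a null set, the superlevel sets of a unimodal density ratio are intervals. -/
theorem HasUnimodalRatio.exists_ae_min_le (h : HasUnimodalRatio Q P) :
    ∃ G : Set ℝ, (∀ᵐ x ∂P, x ∈ G) ∧ ∀ x ∈ G, ∀ y ∈ G, ∀ z ∈ G, x ≤ y → y ≤ z →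
      min (dens Q P x) (dens Q P z) ≤ dens Q P y := by
  obtain ⟨r, m, hr, hmono, hanti⟩ := h
  refine ⟨{x | r x = Q.rnDeriv P x ∧ Q.rnDeriv P x < ∞}, ?_, ?_⟩
  · filter_upwards [hr, Measure.rnDeriv_lt_top Q P] with x h1 h2 using ⟨h1, h2⟩
  · intro x hx y hy z hz hxy hyz
    simp only [dens]
    rcases le_total (y : EReal) m with hm | hm
    · refine min_le_of_left_le (ENNReal.toReal_mono hy.2.ne ?_)
      rw [← hx.1, ← hy.1]
      exact hmono (show (x : EReal) ≤ m from (EReal.coe_le_coe_iff.2 hxy).trans hm) hm hxy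
    · refine min_le_of_right_le (ENNReal.toReal_mono hy.2.ne ?_)
      rw [← hz.1, ← hy.1]
      exact hanti hm (show m ≤ (z : EReal) from hm.trans (EReal.coe_le_coe_iff.2 hyz)) hyz

/-- After a rejected proposal `x`, the unaccounted target mass lies on one side of `x`, and the
branch is continued there. -/
theorem branchProb_zero_or_one (hQP : Q ≪ P) {G : Set ℝ} (hG : ∀ᵐ x ∂P, x ∈ G)
    (hmin : ∀ x ∈ G, ∀ y ∈ G, ∀ z ∈ G, x ≤ y → y ≤ z →
      min (dens Q P x) (dens Q P z) ≤ dens Q P y) (g : Hist) (d : ℕ)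
    (hgood : ∀ᵐ y ∂P, level Q P g d < dens Q P y → y ∈ cell g d) {x : ℝ} (hx : x ∈ G)
    (hxL : dens Q P x ≤ level Q P g (d + 1))
    (hpos : 0 < excess Q P univ (level Q P g (d + 1))) :
    (branchProb Q P (cell g) d (cell g d ∩ Ici x) = 0 ∧
      ∀ᵐ y ∂P, level Q P g (d + 1) < dens Q P y → y ∈ cell g d ∩ Iic x) ∨
    (branchProb Q P (cell g) d (cell g d ∩ Ici x) = 1 ∧
      ∀ᵐ y ∂P, level Q P g (d + 1) < dens Q P y → y ∈ cell g d ∩ Ici x) := by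
  set L := level Q P g (d + 1) with hL
  have hle : level Q P g d ≤ L := level_le_succ Q P g d
  have hcell : ∀ᵐ y ∂P, L < dens Q P y → y ∈ cell g d := by
    filter_upwards [hgood] with y hy h using hy (hle.trans_lt h)
  have hec : excess Q P (cell g d) L = excess Q P univ L := excess_eq_univ Q P hcell
  have hR : MeasurableSet (cell g d ∩ Ici x) := (measurableSet_cell g d).inter measurableSet_Ici
  rw [branchProb_eq hQP g d hR inter_subset_left, ← hL, hec]
  -- Points above the level on both sides of `x`, or at `x`, would force the density at `x` above
  -- `L` as well.
  have hside : (∀ y ∈ G, L < dens Q P y → y < x) ∨ (∀ y ∈ G, L < dens Q P y → x < y) := by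
    by_contra! hcon
    obtain ⟨⟨y, hy, hyL, hxy⟩, z, hz, hzL, hzx⟩ := hcon
    have := hmin z hz x hx y hy hzx hxy
    exact absurd (lt_min hzL hyL) (not_lt.2 (this.trans hxL))
  rcases hside with h | h
  · left
    have hnull : excess Q P (cell g d ∩ Ici x) L = 0 := by
      unfold excess
      refine setIntegral_eq_zero_of_ae_eq_zero ?_
      filter_upwards [hG] with y hy hyR
      refine max_eq_right ?_
      by_contra! hlt
      exact absurd (h y hy (by linarith)) (not_lt.2 hyR.2)
    rw [hnull, ENNReal.ofReal_zero, ENNReal.zero_div]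
    refine ⟨rfl, ?_⟩
    filter_upwards [hG, hcell] with y hy hc hlt using ⟨hc hlt, (h y hy hlt).le⟩
  · right
    have hae : ∀ᵐ y ∂P, L < dens Q P y → y ∈ cell g d ∩ Ici x := by
      filter_upwards [hG, hcell] with y hy hc hlt using ⟨hc hlt, (h y hy hlt).le⟩
    rw [excess_eq_univ Q P hae]
    exact ⟨ENNReal.div_self (by simpa using hpos) ENNReal.ofReal_ne_top, hae⟩

end

/-! ### Joint measurability -/

section

variable {Q P : Measure ℝ} [IsProbabilityMeasure Q] [IsProbabilityMeasure P]

theorem measurableSet_mem_cell (d : ℕ) : MeasurableSet {p : Hist × ℝ | p.2 ∈ cell p.1 d} := by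
  induction d with
  | zero => simp [cell]
  | succ d ih =>
    have e : {p : Hist × ℝ | p.2 ∈ cell p.1 (d + 1)} = {p | p.2 ∈ cell p.1 d} ∩
        (({p | (p.1 d).2 = true} ∩ {p | (p.1 d).1.1 ≤ p.2}) ∪
          ({p | (p.1 d).2 = true}ᶜ ∩ {p | p.2 ≤ (p.1 d).1.1})) := by
      ext p
      cases h : (p.1 d).2 <;> simp [cell, h]
    have hx : Measurable fun p : Hist × ℝ => (p.1 d).1.1 := by fun_prop
    have hb : MeasurableSet {p : Hist × ℝ | (p.1 d).2 = true} :=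
      measurableSet_eq_fun (by fun_prop) measurable_const
    rw [e]
    exact ih.inter ((hb.inter (measurableSet_le hx measurable_snd)).union
      (hb.compl.inter (measurableSet_le measurable_snd hx)))

theorem measurable_measure_cell (d : ℕ) : Measurable fun g : Hist => P (cell g d) :=
  measurable_measure_prodMk_left (measurableSet_mem_cell d)

theorem measurable_level (d : ℕ) : Measurable fun g : Hist => level Q P g d := by
  induction d with
  | zero => exact measurable_const
  | succ d ih =>
    refine ih.add (Measurable.div ?_ (measurable_measure_cell d).ennreal_toReal)
    have hm := measurable_dens Q P
    have hf : Measurable ({p : Hist × ℝ | p.2 ∈ cell p.1 d}.indicator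
        fun p => max (dens Q P p.2 - level Q P p.1 d) 0) := by
      refine Measurable.indicator ?_ (measurableSet_mem_cell d)
      have : Measurable fun p : Hist × ℝ => level Q P p.1 d := ih.comp measurable_fst
      fun_prop
    have e : (fun g : Hist => excess Q P (cell g d) (level Q P g d)) = fun g => ∫ x,
        ({p : Hist × ℝ | p.2 ∈ cell p.1 d}.indicator
          fun p => max (dens Q P p.2 - level Q P p.1 d) 0) (g, x) ∂P := by
      funext g
      rw [excess, ← integral_indicator (measurableSet_cell g d)]
      rfl
    rw [e]
    exact (hf.stronglyMeasurable.integral_prod_right' (ν := P)).measurable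

theorem measurable_excess_level (d : ℕ) :
    Measurable fun g : Hist => excess Q P univ (level Q P g d) := by
  have h : Measurable fun L => excess Q P univ L :=
    (show Antitone fun L => excess Q P univ L from fun _ _ h => excess_anti Q P univ h).measurable
  exact h.comp (measurable_level d)

theorem measurable_splitRatio (d : ℕ) :
    Measurable fun p : Hist × ℝ => splitRatio P (cell p.1 d) p.2 := by
  have h1 : MeasurableSet {p : (Hist × ℝ) × ℝ | p.2 ∈ cell p.1.1 d ∩ Iic p.1.2} :=
    ((measurableSet_mem_cell d).preimage (f := fun p : (Hist × ℝ) × ℝ => (p.1.1, p.2))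
      (by fun_prop)).inter (measurableSet_le (by fun_prop) (by fun_prop))
  have h2 : MeasurableSet {p : (Hist × ℝ) × ℝ | p.2 ∈ cell p.1.1 d ∩ Ici p.1.2} :=
    ((measurableSet_mem_cell d).preimage (f := fun p : (Hist × ℝ) × ℝ => (p.1.1, p.2))
      (by fun_prop)).inter (measurableSet_le (by fun_prop) (by fun_prop))
  have m1 : Measurable fun p : Hist × ℝ => P.real (cell p.1 d ∩ Iic p.2) :=
    (measurable_measure_prodMk_left (ν := P) h1).ennreal_toReal
  have m2 : Measurable fun p : Hist × ℝ => P.real (cell p.1 d ∩ Ici p.2) :=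
    (measurable_measure_prodMk_left (ν := P) h2).ennreal_toReal
  exact (m1.max m2).div ((measurable_measure_cell d).ennreal_toReal.comp measurable_fst)

theorem measurable_virt (d : ℕ) : Measurable fun g : Hist => virt P g d := by
  induction d with
  | zero => exact measurable_const
  | succ d ih =>
    refine ih.mul ?_
    split_ifs
    · exact measurable_const
    · exact (measurable_splitRatio d).comp (g := fun p : Hist × ℝ => splitRatio P (cell p.1 d) p.2)
        (f := fun g : Hist => (g, (g d).1.1)) (by fun_prop)

theorem measurable_ruledOutDensity_joint (d : ℕ) :
    Measurable fun p : Hist × ℝ => ruledOutDensity Q P (cell p.1) d p.2 := by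
  have hq : Measurable fun p : Hist × ℝ => Q.rnDeriv P p.2 :=
    (Measure.measurable_rnDeriv Q P).comp measurable_snd
  induction d with
  | zero => exact measurable_const
  | succ d ih =>
    refine Measurable.ite (measurableSet_mem_cell (d + 1)) (ih.add ?_) hq
    refine (hq.sub ih).min (Measurable.comp (g := fun g : Hist =>
      (1 - P.withDensity (ruledOutDensity Q P (cell g) d) univ) / P (cell g d)) ?_ measurable_fst)
    refine Measurable.div ?_ (measurable_measure_cell d)
    simp only [withDensity_apply _ MeasurableSet.univ, setLIntegral_univ]
    exact measurable_const.sub ih.lintegral_prod_right'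

theorem measurable_acceptProb_joint (d : ℕ) :
    Measurable fun p : Hist × ℝ => acceptProb Q P (cell p.1) d p.2 := by
  have hq : Measurable fun p : Hist × ℝ => Q.rnDeriv P p.2 :=
    (Measure.measurable_rnDeriv Q P).comp measurable_snd
  have hr := measurable_ruledOutDensity_joint (Q := Q) (P := P) d
  have hT : Measurable fun g : Hist => 1 - P.withDensity (ruledOutDensity Q P (cell g) d) univ := by
    simp only [withDensity_apply _ MeasurableSet.univ, setLIntegral_univ]
    exact measurable_const.sub hr.lintegral_prod_right'
  have hs := measurable_measure_cell (P := P) d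
  refine Measurable.mul ((hq.sub hr).min ?_) ?_
  · exact (hT.div hs).comp measurable_fst
  · exact (hs.div hT).comp measurable_fst

/-- The draw `(x, u)` in step `d` is rejected. -/
def rejectSet (Q P : Measure ℝ) (d : ℕ) : Set (Hist × (ℝ × ℝ)) :=
  {p | ¬ ENNReal.ofReal p.2.2 ≤ acceptProb Q P (cell p.1) d p.2.1}

theorem measurableSet_rejectSet (d : ℕ) : MeasurableSet (rejectSet Q P d) := by
  have h := measurable_acceptProb_joint (Q := Q) (P := P) d
  exact (measurableSet_le (ENNReal.measurable_ofReal.comp (by fun_prop))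
    (h.comp (f := fun p : Hist × (ℝ × ℝ) => (p.1, p.2.1)) (by fun_prop))).compl

/-- The histories whose steps before step `d` reject. -/
def reached (Q P : Measure ℝ) (d : ℕ) : Set Hist :=
  {g | ∀ j < d, (g, (g j).1) ∈ rejectSet Q P j}

theorem measurableSet_reached (d : ℕ) : MeasurableSet (reached Q P d) := by
  have e : reached Q P d = ⋂ (j : ℕ) (_ : j < d),
      (fun g : Hist => (g, (g j).1)) ⁻¹' rejectSet Q P j := by
    ext g; simp [reached]
  rw [e]
  exact .iInter fun j => .iInter fun _ => (measurableSet_rejectSet j).preimage (by fun_prop)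

theorem reached_succ (d : ℕ) :
    reached Q P (d + 1) = reached Q P d ∩ {g | (g, (g d).1) ∈ rejectSet Q P d} := by
  ext g
  simp only [reached, mem_inter_iff, mem_ofPred_eq, Nat.lt_succ_iff_lt_or_eq]
  constructor
  · exact fun h => ⟨fun j hj => h j (.inl hj), h d (.inr rfl)⟩
  · rintro ⟨h1, h2⟩ j (hj | rfl)
    exacts [h1 j hj, h2]

theorem measurable_drawLaw_apply (d : ℕ) {B : Set (ℝ × ℝ)} (hB : MeasurableSet B) :
    Measurable fun g : Hist => drawLaw P (cell g d) B := by
  have h1 : Measurable fun x : ℝ => volume.restrict (Icc (0 : ℝ) 1) (Prod.mk x ⁻¹' B) :=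
    measurable_measure_prodMk_left hB
  have h2 : Measurable ({p : Hist × ℝ | p.2 ∈ cell p.1 d}.indicator
      fun p => volume.restrict (Icc (0 : ℝ) 1) (Prod.mk p.2 ⁻¹' B)) :=
    (h1.comp measurable_snd).indicator (measurableSet_mem_cell d)
  have e : (fun g : Hist => drawLaw P (cell g d) B) = fun g => (P (cell g d))⁻¹ * ∫⁻ x,
      ({p : Hist × ℝ | p.2 ∈ cell p.1 d}.indicator
        fun p => volume.restrict (Icc (0 : ℝ) 1) (Prod.mk p.2 ⁻¹' B)) (g, x) ∂P := by
    funext g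
    rw [drawLaw, Measure.prod_apply hB, ProbabilityTheory.cond, lintegral_smul_measure,
      ← lintegral_indicator (measurableSet_cell g d)]
    rfl
  rw [e]
  exact (measurable_measure_cell d).inv.mul h2.lintegral_prod_right'

end

/-! ### Dependence on finitely many steps -/

section

/-- The history before step `d`. -/
def trunc (d : ℕ) (g : Hist) : Hist := fun j => if j < d then g j else ((0, 0), false)

theorem measurable_trunc (d : ℕ) : Measurable (trunc d) := by
  refine measurable_pi_iff.2 fun j => ?_
  unfold trunc
  split_ifs
  exacts [measurable_pi_apply j, measurable_const]

theorem cell_trunc (g : Hist) {d j : ℕ} (h : j ≤ d) : cell (trunc d g) j = cell g j := by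
  induction j with
  | zero => rfl
  | succ j ih => simp [cell, ih (by omega), trunc, show j < d by omega]

variable (Q P : Measure ℝ)

/-- The range exceeds that of `cell_trunc` by one: the level after step `d` uses only the cell of
step `d`, so it is known before the draw of that step. -/
theorem level_trunc (g : Hist) {d j : ℕ} (h : j ≤ d + 1) :
    level Q P (trunc d g) j = level Q P g j := by
  induction j with
  | zero => rfl
  | succ j ih => simp [level, ih (by omega), cell_trunc g (show j ≤ d by omega)]

theorem virt_trunc (g : Hist) {d j : ℕ} (h : j ≤ d) : virt P (trunc d g) j = virt P g j := by
  induction j with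
  | zero => rfl
  | succ j ih =>
    simp [virt, ih (by omega), cell_trunc g (show j ≤ d by omega), trunc, show j < d by omega]

theorem ruledOutDensity_congr {S S' : ℕ → Set ℝ} {d : ℕ} (h : ∀ j ≤ d, S j = S' j) :
    ruledOutDensity Q P S d = ruledOutDensity Q P S' d := by
  induction d with
  | zero => rfl
  | succ d ih =>
    simp only [ruledOutDensity, ih fun j hj => h j (by omega), h d (by omega)]
    rw [h (d + 1) le_rfl]

theorem acceptProb_congr {S S' : ℕ → Set ℝ} {d : ℕ} (h : ∀ j ≤ d, S j = S' j) :
    acceptProb Q P S d = acceptProb Q P S' d := by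
  funext x
  simp only [acceptProb, alpha, ruledOut, ruledOutDensity_congr Q P h, h d le_rfl]

theorem mem_rejectSet_trunc (g : Hist) {d j : ℕ} (h : j ≤ d) (y : ℝ × ℝ) :
    (trunc d g, y) ∈ rejectSet Q P j ↔ (g, y) ∈ rejectSet Q P j := by
  simp only [rejectSet, mem_ofPred_eq]
  rw [acceptProb_congr Q P fun i hi => cell_trunc g (hi.trans h)]

theorem mem_reached_trunc (g : Hist) (d : ℕ) : trunc d g ∈ reached Q P d ↔ g ∈ reached Q P d := by
  refine forall₂_congr fun j hj => ?_
  rw [mem_rejectSet_trunc Q P g hj.le]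
  simp [trunc, hj]

end

/-! ### The potential and its drift -/

section

variable {Q P : Measure ℝ} [IsProbabilityMeasure Q] [IsProbabilityMeasure P]

/-- Transfers the estimates for a probability law on the whole line to the split of a cell. -/
theorem splitRatio_cond {S : Set ℝ} (hS : MeasurableSet S) (hs : 0 < P.real S) (x : ℝ) :
    splitRatio (ProbabilityTheory.cond P S) univ x = splitRatio P S x := by
  have h (T : Set ℝ) : (ProbabilityTheory.cond P S).real T = P.real (S ∩ T) / P.real S := by
    rw [measureReal_def, ProbabilityTheory.cond_apply hS, ENNReal.toReal_mul, ENNReal.toReal_inv,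
      ← measureReal_def, ← measureReal_def, div_eq_inv_mul]
  simp only [splitRatio, univ_inter, h, inter_univ]
  rw [div_self hs.ne', div_one, max_div_div_right hs.le]

theorem half_le_splitRatio {S : Set ℝ} (hs : 0 < P.real S) (x : ℝ) :
    1 / 2 ≤ splitRatio P S x := by
  have h : P.real S ≤ P.real (S ∩ Iic x) + P.real (S ∩ Ici x) := by
    have := measureReal_union_le (μ := P) (S ∩ Iic x) (S ∩ Ici x)
    rwa [← inter_union_distrib_left, Iic_union_Ici, inter_univ] at this
  rw [splitRatio, le_div_iff₀ hs]
  have h1 := le_max_left (P.real (S ∩ Iic x)) (P.real (S ∩ Ici x))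
  have h2 := le_max_right (P.real (S ∩ Iic x)) (P.real (S ∩ Ici x))
  linarith

/-- The properties that hold almost surely as long as no sample has been accepted: target mass is
left, the active set contains the superlevel set, and `virt` bounds its mass and is not too small
in terms of the level. -/
structure Good (Q P : Measure ℝ) (g : Hist) (d : ℕ) : Prop where
  excess_pos : 0 < excess Q P univ (level Q P g d)
  mem_cell : ∀ᵐ y ∂P, level Q P g d < dens Q P y → y ∈ cell g d
  cell_le : P.real (cell g d) ≤ virt P g d
  -- At `d = 0` this fails: the level is `0` and the excess is `1`.
  le_level : d ≠ 0 → excess Q P univ (level Q P g d) ≤ level Q P g d * virt P g d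

theorem excess_univ_zero (hQP : Q ≪ P) : excess Q P univ 0 = 1 := by
  unfold excess
  simp only [sub_zero, max_eq_left (dens_nonneg Q P _), setIntegral_univ]
  unfold dens
  rw [Measure.integral_toReal_rnDeriv hQP]
  simp

theorem level_one (hQP : Q ≪ P) (g : Hist) : level Q P g 1 = 1 := by
  simp [level, cell, excess_univ_zero hQP]

theorem one_le_level (hQP : Q ≪ P) (g : Hist) {d : ℕ} (hd : d ≠ 0) : 1 ≤ level Q P g d := by
  rw [← level_one hQP g]
  exact monotone_nat_of_le_succ (level_le_succ Q P g) (Nat.one_le_iff_ne_zero.2 hd)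

namespace Good

variable {g : Hist} {d : ℕ}

theorem zero (hQP : Q ≪ P) (g : Hist) : Good Q P g 0 where
  excess_pos := by rw [level, excess_univ_zero hQP]; exact one_pos
  mem_cell := by simp [cell]
  cell_le := by simp [cell, virt]
  le_level := by simp

theorem excess_cell (h : Good Q P g d) :
    excess Q P (cell g d) (level Q P g d) = excess Q P univ (level Q P g d) :=
  excess_eq_univ Q P h.mem_cell

theorem excess_cell_pos (h : Good Q P g d) : 0 < excess Q P (cell g d) (level Q P g d) := by
  rw [h.excess_cell]; exact h.excess_pos

theorem cell_pos (h : Good Q P g d) : 0 < P.real (cell g d) := by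
  refine lt_of_le_of_ne measureReal_nonneg fun h0 => h.excess_cell_pos.ne' ?_
  have : P (cell g d) = 0 := by
    rwa [eq_comm, measureReal_eq_zero_iff] at h0
  unfold excess
  rw [Measure.restrict_eq_zero.2 this, integral_zero_measure]

theorem virt_pos (h : Good Q P g d) : 0 < virt P g d := h.cell_pos.trans_le h.cell_le

theorem level_succ (h : Good Q P g d) : level Q P g (d + 1)
    = level Q P g d + excess Q P univ (level Q P g d) / P.real (cell g d) := by
  rw [level, h.excess_cell]

/-- Both summands of the new level, times `virt`, are at least the old excess. The factor `2` pays
for the next split, whose ratio may be as small as `1 / 2`. -/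
theorem two_mul_le_level_succ_mul (h : Good Q P g d) (hd : d ≠ 0) :
    2 * excess Q P univ (level Q P g (d + 1)) ≤ level Q P g (d + 1) * virt P g d := by
  have h1 := h.le_level hd
  have h2 : excess Q P univ (level Q P g d)
      ≤ excess Q P univ (level Q P g d) / P.real (cell g d) * virt P g d := by
    rw [div_mul_eq_mul_div, le_div_iff₀ h.cell_pos]
    exact mul_le_mul_of_nonneg_left h.cell_le h.excess_pos.le
  have h3 := excess_anti Q P univ (level_le_succ Q P g d)
  rw [h.level_succ] at h3 ⊢
  linarith

theorem succ (hQP : Q ≪ P) (h : Good Q P g d)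
    (hpos : 0 < excess Q P univ (level Q P g (d + 1)))
    (hmem : ∀ᵐ y ∂P, level Q P g (d + 1) < dens Q P y → y ∈ cell g (d + 1)) :
    Good Q P g (d + 1) := by
  refine ⟨hpos, hmem, ?_, fun _ => ?_⟩
  · rcases eq_or_ne d 0 with rfl | hd
    · simp [virt, measureReal_le_one]
    · rw [virt, if_neg hd]
      calc P.real (cell g (d + 1))
          ≤ max (P.real (cell g d ∩ Iic (g d).1.1)) (P.real (cell g d ∩ Ici (g d).1.1)) := by
            rw [cell]
            split_ifs
            exacts [le_max_right _ _, le_max_left _ _]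
        _ = P.real (cell g d) * splitRatio P (cell g d) (g d).1.1 := by
            rw [splitRatio, mul_div_cancel₀ _ h.cell_pos.ne']
        _ ≤ _ := mul_le_mul_of_nonneg_right h.cell_le
            (by linarith [half_le_splitRatio h.cell_pos (g d).1.1])
  · rcases eq_or_ne d 0 with rfl | hd
    -- The level after step `0` is `1` and the excess may be close to `1`, so the invariant could
    -- fail if `virt` counted the first split.
    · have h1 := excess_anti Q P univ (zero_le_one' ℝ)
      rw [excess_univ_zero hQP] at h1
      simpa [level_one hQP, virt] using h1
    · have h1 := h.two_mul_le_level_succ_mul hd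
      rw [virt, if_neg hd]
      have h2 : level Q P g (d + 1) * virt P g d * (1 / 2)
          ≤ level Q P g (d + 1) * virt P g d * splitRatio P (cell g d) (g d).1.1 :=
        mul_le_mul_of_nonneg_left (half_le_splitRatio h.cell_pos _)
          (mul_nonneg (level_nonneg Q P g _) h.virt_pos.le)
      linarith

end Good

/-- The part of the relative entropy that is contributed by the density ratio above `L`. -/
def gapIntegral (Q P : Measure ℝ) (L : ℝ) : ℝ := ∫ x, logGap L (dens Q P x) ∂P

/-- The potential after step `d` if the proposal `x` is rejected. -/
def nextPotential (Q P : Measure ℝ) (g : Hist) (d : ℕ) (x : ℝ) : ℝ :=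
  4 / 3 + gapIntegral Q P (level Q P g (d + 1)) / excess Q P univ (level Q P g (d + 1))
    + Real.log (virt P g d * (if d = 0 then 1 else splitRatio P (cell g d) x)
      / excess Q P univ (level Q P g (d + 1)))

/-- The potential before step `d`: a bound for `log (4 / 3)` times the expected number of further
steps. -/
def potential (Q P : Measure ℝ) (g : Hist) (d : ℕ) : ℝ :=
  4 / 3 + gapIntegral Q P (level Q P g d) / excess Q P univ (level Q P g d)
    + Real.log (virt P g d / excess Q P univ (level Q P g d))

theorem potential_succ (g : Hist) (d : ℕ) :
    potential Q P g (d + 1) = nextPotential Q P g d (g d).1.1 := rfl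

theorem measurable_logGap (L : ℝ) : Measurable (logGap L) := by
  unfold logGap logPrim
  fun_prop

theorem integrable_logGap (hkl : Integrable (fun x => InformationTheory.klFun (dens Q P x)) P)
    {L : ℝ} (hL : 1 ≤ L) : Integrable (fun x => logGap L (dens Q P x)) P := by
  refine hkl.mono' ((measurable_logGap L).comp (measurable_dens Q P)).aestronglyMeasurable
    (.of_forall fun x => ?_)
  rw [Real.norm_eq_abs, abs_of_nonneg (logGap_nonneg hL)]
  exact logGap_le_klFun hL (dens_nonneg Q P x)

theorem integral_logGap_add (hkl : Integrable (fun x => InformationTheory.klFun (dens Q P x)) P)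
    {L : ℝ} (hL : 1 ≤ L) (c : ℝ) :
    ∫ x, (logGap L (dens Q P x) + max (dens Q P x - L) 0 * c) ∂P
      = gapIntegral Q P L + excess Q P univ L * c := by
  rw [integral_add (integrable_logGap hkl hL) ((integrable_excess Q P L).mul_const c),
    integral_mul_const, gapIntegral, excess, setIntegral_univ]

theorem gapIntegral_add_nonneg (hkl : Integrable (fun x => InformationTheory.klFun (dens Q P x)) P)
    {L c : ℝ} (hL : 1 ≤ L) (hc : 0 ≤ Real.log L + c) :
    0 ≤ gapIntegral Q P L + excess Q P univ L * c := by
  rw [← integral_logGap_add hkl hL]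
  exact integral_nonneg fun x => logGap_add_nonneg (by linarith) hc

theorem gapIntegral_add_anti (hkl : Integrable (fun x => InformationTheory.klFun (dens Q P x)) P)
    {a b c : ℝ} (ha : 1 ≤ a) (hab : a ≤ b) (hc : 0 ≤ Real.log a + c) :
    gapIntegral Q P b + excess Q P univ b * c ≤ gapIntegral Q P a + excess Q P univ a * c := by
  rw [← integral_logGap_add hkl ha, ← integral_logGap_add hkl (ha.trans hab)]
  exact integral_mono
    ((integrable_logGap hkl (ha.trans hab)).add ((integrable_excess Q P b).mul_const c))
    ((integrable_logGap hkl ha).add ((integrable_excess Q P a).mul_const c))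
    fun x => logGap_add_anti (by linarith) hab hc

theorem log_two_le : Real.log 2 ≤ 1 := by
  have := Real.log_le_sub_one_of_pos (x := 2) two_pos
  linarith

theorem nullSingletonClass_cond [NullSingletonClass P] (S : Set ℝ) :
    NullSingletonClass (ProbabilityTheory.cond P S) :=
  ⟨fun x => ProbabilityTheory.cond_absolutelyContinuous (measure_singleton x)⟩

variable {g : Hist} {d : ℕ}

theorem isProbabilityMeasure_cond_cell (h : Good Q P g d) :
    IsProbabilityMeasure (ProbabilityTheory.cond P (cell g d)) :=
  ProbabilityTheory.cond_isProbabilityMeasure fun h0 => h.cell_pos.ne' (by simp [measureReal_def, h0])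

/-- The probability that step `d` rejects. -/
theorem integral_rejectWeight_cell (h : Good Q P g d) :
    ∫ x, rejectWeight Q P (cell g d) (level Q P g d) x ∂(ProbabilityTheory.cond P (cell g d))
      = excess Q P univ (level Q P g (d + 1)) / excess Q P univ (level Q P g d) := by
  rw [integral_rejectWeight h.cell_pos h.excess_cell_pos, ← level, h.excess_cell]
  congr 1
  refine excess_eq_univ Q P ?_
  filter_upwards [h.mem_cell] with y hy hlt using hy ((level_le_succ Q P g d).trans_lt hlt)

theorem lintegral_rejectWeight_cell (h : Good Q P g d) :
    ∫⁻ x, ENNReal.ofReal (rejectWeight Q P (cell g d) (level Q P g d) x)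
        ∂(ProbabilityTheory.cond P (cell g d))
      = ENNReal.ofReal
        (excess Q P univ (level Q P g (d + 1)) / excess Q P univ (level Q P g d)) := by
  have := isProbabilityMeasure_cond_cell h
  have hm := rejectWeight_mem (Q := Q) h.cell_pos h.excess_cell_pos
  rw [← integral_rejectWeight_cell h, ofReal_integral_eq_lintegral_ofReal]
  · refine Integrable.of_bound (C := 1) (measurable_rejectWeight _ _).aestronglyMeasurable
      (.of_forall fun x => ?_)
    rw [Real.norm_eq_abs, abs_of_nonneg (hm x).1]
    exact (hm x).2
  · exact .of_forall fun x => (hm x).1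

/-- With no mass above the next level the step accepts almost surely. This disposes of the case in
which the potential would divide by zero. -/
theorem lintegral_rejectWeight_mul_of_excess_eq_zero (h : Good Q P g d)
    (h0 : excess Q P univ (level Q P g (d + 1)) = 0) (f : ℝ → ℝ≥0∞) :
    ∫⁻ x, ENNReal.ofReal (rejectWeight Q P (cell g d) (level Q P g d) x) * f x
        ∂(ProbabilityTheory.cond P (cell g d)) = 0 := by
  have h1 := lintegral_rejectWeight_cell h
  rw [h0, zero_div, ENNReal.ofReal_zero, lintegral_eq_zero_iff
    (measurable_rejectWeight _ _).ennreal_ofReal] at h1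
  refine (lintegral_congr_ae ?_).trans lintegral_zero
  filter_upwards [h1] with x hx
  simp only [Pi.zero_apply] at hx
  rw [hx, zero_mul]

/-- All heights counted by `gapIntegral` exceed the level, and `le_level` makes `log y + log (v /
W)` nonnegative there. Nonnegativity makes `ENNReal.ofReal` additive on `log (4 / 3)` plus the
potential. -/
theorem Good.potential_nonneg (hQP : Q ≪ P)
    (hkl : Integrable (fun x => InformationTheory.klFun (dens Q P x)) P) (hd : d ≠ 0)
    (h : Good Q P g d) : 0 ≤ potential Q P g d := by
  have hW := h.excess_pos
  have hL := one_le_level hQP g hd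
  have hlogL : 0 ≤ Real.log (level Q P g d)
      + Real.log (virt P g d / excess Q P univ (level Q P g d)) := by
    rw [← Real.log_mul (by linarith) (div_pos h.virt_pos hW).ne']
    refine Real.log_nonneg ?_
    rw [← mul_div_assoc, le_div_iff₀ hW, one_mul]
    exact h.le_level hd
  have := div_nonneg (gapIntegral_add_nonneg hkl hL hlogL) hW.le
  rw [add_div, mul_div_cancel_left₀ _ hW.ne'] at this
  unfold potential
  linarith

/-- The drift of the potential in a step `d ≥ 1`. -/
theorem lintegral_nextPotential_le [NullSingletonClass P] (hQP : Q ≪ P)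
    (hkl : Integrable (fun x => InformationTheory.klFun (dens Q P x)) P) (hd : d ≠ 0)
    (h : Good Q P g d) :
    ∫⁻ x, ENNReal.ofReal (rejectWeight Q P (cell g d) (level Q P g d) x)
        * ENNReal.ofReal (Real.log (4 / 3) + nextPotential Q P g d x)
        ∂(ProbabilityTheory.cond P (cell g d))
      ≤ ENNReal.ofReal (potential Q P g d) := by
  rcases (excess_nonneg Q P univ (level Q P g (d + 1))).eq_or_lt with h0 | h0
  · rw [lintegral_rejectWeight_mul_of_excess_eq_zero h h0.symm]
    exact zero_le
  have := isProbabilityMeasure_cond_cell h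
  have := nullSingletonClass_cond (P := P) (cell g d)
  have hm := rejectWeight_mem (Q := Q) h.cell_pos h.excess_cell_pos
  have hL := one_le_level hQP g hd
  have hLL := level_le_succ Q P g d
  have ht := integral_rejectWeight_cell h
  have hW := h.excess_pos
  have hv := h.virt_pos
  have hWW := excess_anti Q P univ hLL
  have h1 := h.le_level hd
  have h2 := h.two_mul_le_level_succ_mul hd
  have hr x := half_le_splitRatio (P := P) h.cell_pos x
  have hsplit x := splitRatio_cond (measurableSet_cell g d) h.cell_pos x
  unfold nextPotential potential
  simp only [if_neg hd]
  set L := level Q P g d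
  set L' := level Q P g (d + 1)
  set W := excess Q P univ L
  set W' := excess Q P univ L'
  set v := virt P g d
  have ht0 : 0 < W' / W := div_pos h0 hW
  have ht1 : W' / W ≤ 1 := (div_le_one hW).2 hWW
  have hlogL : 0 ≤ Real.log L + Real.log (v / W) := by
    rw [← Real.log_mul (by linarith) (div_pos hv hW).ne']
    refine Real.log_nonneg ?_
    rwa [← mul_div_assoc, le_div_iff₀ hW, one_mul]
  have hlogL' : 0 ≤ Real.log L' + Real.log (v / W') := by
    rw [← Real.log_mul (by linarith) (div_pos hv h0).ne']
    refine Real.log_nonneg ?_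
    rw [← mul_div_assoc, le_div_iff₀ h0]
    linarith
  have hnn := gapIntegral_add_nonneg hkl (hL.trans hLL) hlogL'
  have hanti := gapIntegral_add_anti hkl hL hLL hlogL
  have hlam : 0 ≤ Real.log (4 / 3) := Real.log_nonneg (by norm_num)
  -- The summand `4 / 3` alone exceeds `log 2`; the invariants make the remaining terms nonnegative.
  have hc : Real.log 2 ≤ Real.log (4 / 3)
      + (4 / 3 + gapIntegral Q P L' / W' + Real.log (v / W')) := by
    have : 0 ≤ gapIntegral Q P L' / W' + Real.log (v / W') := by
      have := div_nonneg hnn h0.le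
      rwa [add_div, mul_div_cancel_left₀ _ h0.ne'] at this
    linarith [log_two_le]
  have key := lintegral_mul_log_splitRatio_le (ν := ProbabilityTheory.cond P (cell g d))
    (measurable_rejectWeight (Q := Q) (P := P) (cell g d) L) (fun x => (hm x).1)
    (fun x => (hm x).2) _ hc ht.symm
  refine le_trans (le_of_eq ?_) (key.trans (ENNReal.ofReal_le_ofReal ?_))
  · refine lintegral_congr fun x => ?_
    rw [hsplit, mul_div_right_comm, Real.log_mul (div_pos hv h0).ne' (by linarith [hr x])]
    congr 2
    ring
  -- With `t = W' / W`, the term `-t log t` split off from `t log (v / W')` joins the tilt loss. The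
  -- remaining entropy terms are monotone in the level for the fixed constant `log (v / W)`.
  · have htilt := tilt_loss_le ht0 ht1
    have e1 : Real.log (v / W') = Real.log (v / W) - Real.log (W' / W) := by
      rw [← Real.log_div (div_pos hv hW).ne' ht0.ne']
      congr 1
      field_simp
    have e2 : W' / W * (gapIntegral Q P L' / W') = gapIntegral Q P L' / W := by
      field_simp
    have e3 : gapIntegral Q P L' / W + W' / W * Real.log (v / W)
        ≤ gapIntegral Q P L / W + Real.log (v / W) := by
      have := div_le_div_of_nonneg_right hanti hW.le
      rw [add_div, add_div, mul_div_cancel_left₀ _ hW.ne', mul_div_right_comm] at this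
      exact this
    rw [e1]
    linear_combination htilt + e3 + e2

/-- The drift of the potential in step `0`. -/
theorem lintegral_nextPotential_zero_le (hQP : Q ≪ P)
    (hkl : Integrable (fun x => InformationTheory.klFun (dens Q P x)) P) (g : Hist) :
    ∫⁻ x, ENNReal.ofReal (rejectWeight Q P (cell g 0) (level Q P g 0) x)
        * ENNReal.ofReal (Real.log (4 / 3) + nextPotential Q P g 0 x)
        ∂(ProbabilityTheory.cond P (cell g 0))
      ≤ ENNReal.ofReal (∫ x, InformationTheory.klFun (dens Q P x) ∂P + 4 * Real.log (4 / 3)) := by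
  have h := Good.zero hQP g
  rcases (excess_nonneg Q P univ (level Q P g 1)).eq_or_lt with h0 | h0
  · rw [lintegral_rejectWeight_mul_of_excess_eq_zero h h0.symm]
    exact zero_le
  simp only [nextPotential, zero_add, if_true]
  -- In step `0` the split ratio is replaced by `1`, so the potential does not depend on the
  -- proposal and factors out.
  rw [lintegral_mul_const _ (measurable_rejectWeight _ _).ennreal_ofReal,
    lintegral_rejectWeight_cell h, zero_add, level_one hQP, level, excess_univ_zero hQP, div_one,
    virt, mul_one, ← ENNReal.ofReal_mul (excess_nonneg Q P _ _)]
  rw [level_one hQP] at h0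
  refine ENNReal.ofReal_le_ofReal ?_
  set t := excess Q P univ 1
  have hfirst := first_step_le h0
  -- The density minus `1` has mean zero, so its deficit below `1` equals its excess above `1`.
  have hloss : ∫ x, max (1 - dens Q P x) 0 ∂P = t := by
    have e (x : ℝ) : max (1 - dens Q P x) 0 = max (dens Q P x - 1) 0 - (dens Q P x - 1) := by
      rcases le_total (dens Q P x) 1 with h | h
      · rw [max_eq_left (by linarith), max_eq_right (by linarith)]; ring
      · rw [max_eq_right (by linarith), max_eq_left (by linarith)]; ring
    have h1 : ∫ x, dens Q P x ∂P = 1 := by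
      unfold dens
      rw [Measure.integral_toReal_rnDeriv hQP]
      simp
    have hi1 : Integrable (fun x => dens Q P x - 1) P :=
      (integrable_dens Q P).sub (integrable_const _)
    simp_rw [e]
    rw [integral_sub (integrable_excess Q P 1) hi1,
      integral_sub (integrable_dens Q P) (integrable_const _), h1]
    simp only [integral_const, probReal_univ, smul_eq_mul, mul_one, sub_self, sub_zero]
    simp only [t, excess, setIntegral_univ]
  have hi : Integrable (fun x => max (1 - dens Q P x) 0) P :=
    ((integrable_const 1).sub (integrable_dens Q P)).pos_part
  have hi2 : Integrable (fun x => 2 / 3 - Real.log 3 + max (1 - dens Q P x) 0 * Real.log 3) P :=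
    (integrable_const _).add (hi.mul_const _)
  have hkey : ∫ x, (logGap 1 (dens Q P x)
      + (2 / 3 - Real.log 3 + max (1 - dens Q P x) 0 * Real.log 3)) ∂P
      ≤ ∫ x, InformationTheory.klFun (dens Q P x) ∂P :=
    integral_mono ((integrable_logGap hkl le_rfl).add hi2) hkl
      fun x => logGap_one_add_le_klFun (dens_nonneg Q P x)
  rw [integral_add (integrable_logGap hkl le_rfl) hi2,
    integral_add (integrable_const _) (hi.mul_const _), integral_mul_const, hloss] at hkey
  simp only [integral_const, probReal_univ, smul_eq_mul, one_mul] at hkey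
  rw [← gapIntegral] at hkey
  have e : t * (gapIntegral Q P 1 / t) = gapIntegral Q P 1 := mul_div_cancel₀ _ h0.ne'
  rw [one_div, Real.log_inv]
  linear_combination hfirst + hkey + e

theorem measurable_nextPotential (d : ℕ) :
    Measurable fun p : Hist × ℝ => nextPotential Q P p.1 d p.2 := by
  have hL := measurable_level (Q := Q) (P := P) (d + 1)
  have hW := measurable_excess_level (Q := Q) (P := P) (d + 1)
  have hv := measurable_virt (P := P) d
  have hr : Measurable fun p : Hist × ℝ =>
      if d = 0 then (1 : ℝ) else splitRatio P (cell p.1 d) p.2 := by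
    split_ifs
    exacts [measurable_const, measurable_splitRatio d]
  have hJ : Measurable (gapIntegral Q P) := by
    have : Measurable fun p : ℝ × ℝ => logGap p.1 (dens Q P p.2) := by
      have := measurable_dens Q P
      unfold logGap logPrim
      fun_prop
    exact (this.stronglyMeasurable.integral_prod_right' (ν := P)).measurable
  have hJL : Measurable fun g : Hist => gapIntegral Q P (level Q P g (d + 1)) := hJ.comp hL
  exact (measurable_const.add ((hJL.div hW).comp measurable_fst)).add
    (Real.measurable_log.comp (((hv.comp measurable_fst).mul hr).div (hW.comp measurable_fst)))

end

/-! ### Runs of the sampler -/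

section

variable {Q P : Measure ℝ} [IsProbabilityMeasure Q] [IsProbabilityMeasure P]

theorem branchProb_trunc (g : Hist) (d : ℕ) (R : Set ℝ) :
    branchProb Q P (cell (trunc d g)) d R = branchProb Q P (cell g) d R := by
  simp only [branchProb, ruledOut, accepted, alpha,
    ruledOutDensity_congr Q P fun i hi => cell_trunc g hi, cell_trunc g le_rfl]

theorem measurable_branchProb_joint (hQP : Q ≪ P) (d : ℕ) : Measurable fun p : Hist × ℝ =>
    branchProb Q P (cell p.1) d (cell p.1 d ∩ Ici p.2) := by
  have hm : Measurable fun p : (Hist × ℝ) × ℝ =>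
      Q.rnDeriv P p.2 - ENNReal.ofReal (level Q P p.1.1 (d + 1)) :=
    ((Measure.measurable_rnDeriv Q P).comp measurable_snd).sub
      ((measurable_level (Q := Q) (P := P) (d + 1)).comp
        (measurable_fst.comp measurable_fst)).ennreal_ofReal
  have h1 : MeasurableSet {p : (Hist × ℝ) × ℝ | p.2 ∈ cell p.1.1 d} :=
    (measurableSet_mem_cell d).preimage (f := fun p : (Hist × ℝ) × ℝ => (p.1.1, p.2))
      (by fun_prop)
  have h2 : MeasurableSet {p : (Hist × ℝ) × ℝ | p.2 ∈ cell p.1.1 d ∩ Ici p.1.2} :=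
    h1.inter (measurableSet_le (by fun_prop) (by fun_prop))
  have e : (fun p : Hist × ℝ => branchProb Q P (cell p.1) d (cell p.1 d ∩ Ici p.2)) = fun p =>
      (∫⁻ y, {p : (Hist × ℝ) × ℝ | p.2 ∈ cell p.1.1 d ∩ Ici p.1.2}.indicator (fun p =>
        Q.rnDeriv P p.2 - ENNReal.ofReal (level Q P p.1.1 (d + 1))) (p, y) ∂P) /
      (∫⁻ y, {p : (Hist × ℝ) × ℝ | p.2 ∈ cell p.1.1 d}.indicator (fun p =>
        Q.rnDeriv P p.2 - ENNReal.ofReal (level Q P p.1.1 (d + 1))) (p, y) ∂P) := by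
    funext p
    have hR := (measurableSet_cell p.1 d).inter (measurableSet_Ici (a := p.2))
    rw [branchProb_eq hQP p.1 d hR inter_subset_left,
      ofReal_excess_eq_lintegral Q P _ (level_nonneg Q P _ _),
      ofReal_excess_eq_lintegral Q P _ (level_nonneg Q P _ _), ← lintegral_indicator hR,
      ← lintegral_indicator (measurableSet_cell p.1 d)]
    rfl
  rw [e]
  exact (hm.indicator h2).lintegral_prod_right'.div (hm.indicator h1).lintegral_prod_right'

end

/-- If `y` has the conditional law `κ (h ω)` given `h ω ∈ N`, then functions of `h ω` and `y` can be
integrated by first integrating over `y`. -/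
theorem lintegral_of_condLaw {Ω H Y : Type*} [MeasurableSpace Ω] [MeasurableSpace H]
    [MeasurableSpace Y] {μ : Measure Ω} [IsFiniteMeasure μ] {h : Ω → H} (hh : Measurable h)
    {y : Ω → Y} (hy : Measurable y) {κ : H → Measure Y}
    (hκ : ∀ B, MeasurableSet B → Measurable fun g => κ g B) (hκ1 : ∀ g, κ g univ ≤ 1)
    {N : Set H} (hN : MeasurableSet N)
    (hlaw : ∀ A, MeasurableSet A → A ⊆ N → ∀ B, MeasurableSet B →
      μ (h ⁻¹' A ∩ y ⁻¹' B) = ∫⁻ ω in h ⁻¹' A, κ (h ω) B ∂μ)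
    {F : H × Y → ℝ≥0∞} (hF : Measurable F) :
    ∫⁻ ω in h ⁻¹' N, F (h ω, y ω) ∂μ = ∫⁻ ω in h ⁻¹' N, ∫⁻ z, F (h ω, z) ∂(κ (h ω)) ∂μ := by
  let K : ProbabilityTheory.Kernel H Y := ⟨κ, Measure.measurable_of_measurable_coe _ hκ⟩
  have hK : ProbabilityTheory.IsFiniteKernel K := ⟨1, ENNReal.one_lt_top, hκ1⟩
  have hpair : Measurable fun ω => (h ω, y ω) := hh.prodMk hy
  -- Finite measures on a product are determined by rectangles; intersecting the first side with `N`
  -- brings `hlaw` into play.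
  have key : (μ.restrict (h ⁻¹' N)).map (fun ω => (h ω, y ω))
      = ((μ.restrict (h ⁻¹' N)).map h).compProd K := by
    refine Measure.ext_prod fun {A B} hA hB => ?_
    rw [Measure.compProd_apply_prod hA hB]
    change _ = ∫⁻ g in A, κ g B ∂((μ.restrict (h ⁻¹' N)).map h)
    rw [Measure.map_apply hpair (hA.prod hB), setLIntegral_map hA (hκ B hB) hh, Measure.restrict_apply (hpair (hA.prod hB)),
      Measure.restrict_restrict (hh hA), ← preimage_inter,
      ← hlaw (A ∩ N) (hA.inter hN) inter_subset_right B hB]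
    congr 1
    ext ω
    simp only [mem_inter_iff, mem_preimage, mem_prod]
    tauto
  calc ∫⁻ ω in h ⁻¹' N, F (h ω, y ω) ∂μ
      = ∫⁻ p, F p ∂((μ.restrict (h ⁻¹' N)).map (fun ω => (h ω, y ω))) :=
        (lintegral_map hF hpair).symm
    _ = ∫⁻ g, ∫⁻ z, F (g, z) ∂(K g) ∂((μ.restrict (h ⁻¹' N)).map h) := by
        rw [key, Measure.lintegral_compProd hF]
    _ = _ := lintegral_map (hF.lintegral_kernel_prod_right' (κ := K)) hh

/-! ### Runs as random histories: conditional laws and almost sure invariants. -/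

section Run

variable {Ω : Type*} [MeasurableSpace Ω]

/-- The draws and coin tosses along the branch of the run. -/
def full (X U : ℕ → Ω → ℝ) (b : ℕ → Ω → Bool) (ω : Ω) : Hist :=
  fun j => (drawn X U b j ω, b j ω)

theorem heapIndex_pos (b : ℕ → Bool) (d : ℕ) : 1 ≤ heapIndex b d := by
  induction d with
  | zero => exact le_rfl
  | succ d ih => rw [heapIndex]; omega

theorem active_eq_cell (X U : ℕ → Ω → ℝ) (b : ℕ → Ω → Bool) (ω : Ω) :
    active X b ω = cell (full X U b ω) := by
  funext d
  induction d with
  | zero => exact splitCell_one _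
  | succ d ih =>
    have hpos := heapIndex_pos (fun j => b j ω) d
    rw [cell, ← ih]
    simp only [active, activeSet, heapIndex, full, drawn, idx]
    rcases Bool.eq_false_or_eq_true (b d ω) with h | h
    · simp [h, splitCell_two_mul_add_one _ hpos]
    · simp [h, splitCell_two_mul _ hpos]

theorem le_steps_iff (Q P : Measure ℝ) (X U : ℕ → Ω → ℝ) (b : ℕ → Ω → Bool) (ω : Ω) (d : ℕ) :
    (d : ℕ∞) ≤ steps Q P X U b ω ↔ full X U b ω ∈ reached Q P d := by
  simp only [steps, numSteps, le_iInf_iff, reached, mem_ofPred_eq, rejectSet, ← active_eq_cell]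
  refine forall_congr' fun j => ?_
  rw [Nat.cast_le, ← not_lt]
  exact imp_not_comm

variable {Q P : Measure ℝ} [IsProbabilityMeasure Q] [IsProbabilityMeasure P]
  {μ : Measure Ω} [IsProbabilityMeasure μ] {X U : ℕ → Ω → ℝ} {b : ℕ → Ω → Bool}

theorem measurable_trunc_full_past (X U : ℕ → Ω → ℝ) (b : ℕ → Ω → Bool) (d : ℕ) :
    Measurable[past X U b d] fun ω => trunc d (full X U b ω) := by
  refine @measurable_pi_lambda _ _ _ (past X U b d) _ _ fun j => ?_
  by_cases hj : j < d
  · simp only [trunc, if_pos hj]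
    refine Measurable.mono (comap_measurable (fun ω => (drawn X U b j ω, b j ω))) ?_ le_rfl
    exact le_iSup₂_of_le j hj le_rfl
  · simp only [trunc, if_neg hj]
    exact measurable_const

theorem measurable_trunc_full_drawn (X U : ℕ → Ω → ℝ) (b : ℕ → Ω → Bool) (d : ℕ) :
    Measurable[past X U b d ⊔ MeasurableSpace.comap (drawn X U b d) inferInstance]
      fun ω => (trunc d (full X U b ω), drawn X U b d ω) :=
  Measurable.prodMk ((measurable_trunc_full_past X U b d).mono le_sup_left le_rfl)
    ((comap_measurable (drawn X U b d)).mono le_sup_right le_rfl)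

namespace IsGRCSRun

variable (hrun : IsGRCSRun Q P μ X U b)
include hrun

theorem measurable_idx (d : ℕ) : Measurable (idx b d) := by
  induction d with
  | zero => exact measurable_const
  | succ d ih =>
    have h : Measurable fun ω => (idx b d ω, b d ω) := ih.prodMk (hrun.measurable_b d)
    exact (measurable_of_countable fun p : ℕ × Bool => 2 * p.1 + p.2.toNat).comp h

theorem measurable_drawn (d : ℕ) : Measurable (drawn X U b d) := by
  have hi := hrun.measurable_idx d
  have h {Z : ℕ → Ω → ℝ} (hZ : ∀ n, Measurable (Z n)) : Measurable fun ω => Z (idx b d ω) ω :=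
    (measurable_from_prod_countable_right (f := fun p : ℕ × Ω => Z p.1 p.2) hZ).comp
      (hi.prodMk measurable_id)
  exact (h hrun.measurable_X).prodMk (h hrun.measurable_U)

theorem measurable_full : Measurable (full X U b) :=
  measurable_pi_iff.2 fun j => (hrun.measurable_drawn j).prodMk (hrun.measurable_b j)

theorem measurableSet_reached_full (d : ℕ) :
    MeasurableSet (full X U b ⁻¹' reached Q P d) :=
  (measurableSet_reached d).preimage hrun.measurable_full

/-- Integration over the draw of a step. -/
theorem lintegral_draw (d : ℕ) {F : Hist × (ℝ × ℝ) → ℝ≥0∞} (hF : Measurable F)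
    (hFt : ∀ g y, F (trunc d g, y) = F (g, y)) :
    ∫⁻ ω in full X U b ⁻¹' reached Q P d, F (full X U b ω, drawn X U b d ω) ∂μ
      = ∫⁻ ω in full X U b ⁻¹' reached Q P d,
          ∫⁻ y, F (full X U b ω, y) ∂(drawLaw P (cell (full X U b ω) d)) ∂μ := by
  have hh : Measurable fun ω => trunc d (full X U b ω) :=
    (measurable_trunc d).comp hrun.measurable_full
  have hpre : (fun ω => trunc d (full X U b ω)) ⁻¹' reached Q P d
      = full X U b ⁻¹' reached Q P d := by
    ext ω
    exact mem_reached_trunc Q P _ d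
  -- The conditional law is only prescribed on events of the past, hence the truncated history;
  -- `hFt` says that `F` sees no more of it.
  have key := lintegral_of_condLaw (μ := μ) (h := fun ω => trunc d (full X U b ω)) hh
    (hrun.measurable_drawn d) (κ := fun g => drawLaw P (cell g d))
    (fun B hB => measurable_drawLaw_apply (P := P) d hB) (fun g => ?_) (measurableSet_reached (Q := Q) (P := P) d)
    (fun A hA hAN B hB => ?_) hF
  · rw [hpre] at key
    simpa only [hFt, cell_trunc _ le_rfl] using key
  -- Only `≤ 1` holds for every history: on a null cell the conditional law is the zero measure.
  · rw [drawLaw, ← univ_prod_univ, Measure.prod_prod, Measure.restrict_apply .univ, univ_inter,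
      Real.volume_Icc]
    have : ProbabilityTheory.cond P (cell g d) univ ≤ 1 := prob_le_one
    simpa using this
  · rw [hrun.draw d _ (measurable_trunc_full_past X U b d hA) (fun ω hω => ?_) B hB]
    · simp only [active_eq_cell X U b, cell_trunc _ le_rfl]
      rfl
    · exact (le_steps_iff Q P X U b ω d).2 ((mem_reached_trunc Q P _ d).1 (hAN hω))

/-- Integration over the rejected proposals of a step. -/
theorem lintegral_reached_succ (hQP : Q ≪ P) {d : ℕ}
    (hgood : ∀ᵐ ω ∂μ, full X U b ω ∈ reached Q P d → Good Q P (full X U b ω) d)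
    {f : Hist × ℝ → ℝ≥0∞} (hf : Measurable f) (hft : ∀ g x, f (trunc d g, x) = f (g, x)) :
    ∫⁻ ω in full X U b ⁻¹' reached Q P (d + 1), f (full X U b ω, (full X U b ω d).1.1) ∂μ
      = ∫⁻ ω in full X U b ⁻¹' reached Q P d, ∫⁻ x,
          ENNReal.ofReal (rejectWeight Q P (cell (full X U b ω) d)
            (level Q P (full X U b ω) d) x) * f (full X U b ω, x)
          ∂(ProbabilityTheory.cond P (cell (full X U b ω) d)) ∂μ := by
  have hF : Measurable ((rejectSet Q P d).indicator
      fun p : Hist × (ℝ × ℝ) => f (p.1, p.2.1)) :=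
    (hf.comp (by fun_prop)).indicator (measurableSet_rejectSet d)
  have hFt : ∀ (g : Hist) (y : ℝ × ℝ), (rejectSet Q P d).indicator
      (fun p : Hist × (ℝ × ℝ) => f (p.1, p.2.1)) (trunc d g, y) = (rejectSet Q P d).indicator
      (fun p : Hist × (ℝ × ℝ) => f (p.1, p.2.1)) (g, y) := fun g y => by
    by_cases h : (g, y) ∈ rejectSet Q P d
    · rw [indicator_of_mem h, indicator_of_mem ((mem_rejectSet_trunc Q P g le_rfl y).2 h), hft]
    · rw [indicator_of_notMem h,
        indicator_of_notMem (mt (mem_rejectSet_trunc Q P g le_rfl y).1 h)]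
  have hrej : MeasurableSet {ω | (full X U b ω, drawn X U b d ω) ∈ rejectSet Q P d} :=
    (measurableSet_rejectSet d).preimage (hrun.measurable_full.prodMk (hrun.measurable_drawn d))
  have key := hrun.lintegral_draw d hF hFt
  have hset : full X U b ⁻¹' reached Q P (d + 1) = full X U b ⁻¹' reached Q P d ∩
      {ω | (full X U b ω, drawn X U b d ω) ∈ rejectSet Q P d} := by
    rw [reached_succ]; rfl
  rw [hset, inter_comm, ← Measure.restrict_restrict hrej, ← lintegral_indicator hrej]
  refine Eq.trans ?_ (key.trans ?_)
  · rfl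
  · refine setLIntegral_congr_fun_ae (hrun.measurableSet_reached_full d) ?_
    filter_upwards [hgood] with ω hω hr
    have hg := hω hr
    exact lintegral_drawLaw_reject hQP hg.cell_pos hg.excess_cell_pos
      (f := fun x => f (full X U b ω, x)) (hf.comp (by fun_prop))

/-- A property of rejected proposals that holds almost surely under the law of the step. -/
theorem ae_reached_succ (hQP : Q ≪ P) {d : ℕ}
    (hgood : ∀ᵐ ω ∂μ, full X U b ω ∈ reached Q P d → Good Q P (full X U b ω) d)
    {B : Set (Hist × ℝ)} (hB : MeasurableSet B) (hBt : ∀ g x, (trunc d g, x) ∈ B ↔ (g, x) ∈ B)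
    (hnull : ∀ g, Good Q P g d → ∫⁻ x, ENNReal.ofReal (rejectWeight Q P (cell g d)
      (level Q P g d) x) * B.indicator (fun _ => 1) (g, x)
      ∂(ProbabilityTheory.cond P (cell g d)) = 0) :
    ∀ᵐ ω ∂μ, full X U b ω ∈ reached Q P (d + 1) →
      (full X U b ω, (full X U b ω d).1.1) ∉ B := by
  have hf : Measurable (B.indicator fun _ => (1 : ℝ≥0∞)) := measurable_const.indicator hB
  have hft : ∀ (g : Hist) (x : ℝ), B.indicator (fun _ => (1 : ℝ≥0∞)) (trunc d g, x)
      = B.indicator (fun _ => 1) (g, x) := fun g x => by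
    by_cases h : (g, x) ∈ B
    · rw [indicator_of_mem h, indicator_of_mem ((hBt g x).2 h)]
    · rw [indicator_of_notMem h, indicator_of_notMem (mt (hBt g x).1 h)]
  have h := hrun.lintegral_reached_succ hQP hgood hf hft
  have h0 : ∫⁻ ω in full X U b ⁻¹' reached Q P d, ∫⁻ x,
          ENNReal.ofReal (rejectWeight Q P (cell (full X U b ω) d)
            (level Q P (full X U b ω) d) x) * B.indicator (fun _ => 1) (full X U b ω, x)
          ∂(ProbabilityTheory.cond P (cell (full X U b ω) d)) ∂μ = 0 := by
    rw [setLIntegral_congr_fun_ae (g := fun _ => 0) (hrun.measurableSet_reached_full d),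
      lintegral_zero]
    filter_upwards [hgood] with ω hω hr using hnull _ (hω hr)
  have hx : Measurable fun ω => (full X U b ω, (full X U b ω d).1.1) :=
    hrun.measurable_full.prodMk (hrun.measurable_drawn d).fst
  have hfx : Measurable fun ω => B.indicator (fun _ => (1 : ℝ≥0∞))
      (full X U b ω, (full X U b ω d).1.1) := hf.comp hx
  rw [h0, lintegral_eq_zero_iff hfx, Filter.EventuallyEq,
    ae_restrict_iff' (hrun.measurableSet_reached_full _)] at h
  filter_upwards [h] with ω hω hr hmem
  have := hω hr
  simp [hmem] at this

/-- The branch is almost surely continued into the child with all the remaining target mass. -/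
theorem ae_coin (hQP : Q ≪ P) (d : ℕ) :
    ∀ᵐ ω ∂μ, full X U b ω ∈ reached Q P (d + 1) →
      (branchProb Q P (cell (full X U b ω)) d
          (cell (full X U b ω) d ∩ Ici (full X U b ω d).1.1) = 0 → b d ω = false) ∧
      (branchProb Q P (cell (full X U b ω)) d
          (cell (full X U b ω) d ∩ Ici (full X U b ω d).1.1) = 1 → b d ω = true) := by
  set bp : Ω → ℝ≥0∞ := fun ω => branchProb Q P (cell (full X U b ω)) d
    (cell (full X U b ω) d ∩ Ici (full X U b ω d).1.1) with hbp
  have hbm : Measurable fun p : Hist × (ℝ × ℝ) =>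
      branchProb Q P (cell p.1) d (cell p.1 d ∩ Ici p.2.1) :=
    (measurable_branchProb_joint hQP d).comp
      (f := fun p : Hist × (ℝ × ℝ) => (p.1, p.2.1)) (by fun_prop)
  have hE (c : ℝ≥0∞) : MeasurableSet[past X U b d ⊔
      MeasurableSpace.comap (drawn X U b d) inferInstance] {ω | full X U b ω ∈ reached Q P (d + 1) ∧ bp ω = c} := by
    have hA : MeasurableSet {p : Hist × (ℝ × ℝ) | (p.1 ∈ reached Q P d ∧ p ∈ rejectSet Q P d) ∧
        branchProb Q P (cell p.1) d (cell p.1 d ∩ Ici p.2.1) = c} :=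
      (((measurableSet_reached d).preimage measurable_fst).inter (measurableSet_rejectSet d)).inter
        (measurableSet_eq_fun hbm measurable_const)
    have := measurable_trunc_full_drawn X U b d hA
    convert this using 1
    ext ω
    simp only [mem_ofPred_eq, mem_preimage, mem_reached_trunc, mem_rejectSet_trunc Q P _ le_rfl,
      branchProb_trunc, cell_trunc _ (le_refl d), reached_succ, mem_inter_iff, hbp]
    rfl
  have hmle : past X U b d ⊔ MeasurableSpace.comap (drawn X U b d) inferInstance
      ≤ ‹MeasurableSpace Ω› := by
    refine sup_le (iSup₂_le fun j _ => ?_) (hrun.measurable_drawn d).comap_le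
    exact ((hrun.measurable_drawn j).prodMk (hrun.measurable_b j)).comap_le
  -- On the event that the branch probability is `c`, the law of the coin integrates a constant. For
  -- `c = 0` heads is null; for `c = 1` heads has the full mass of the event, so tails is null.
  have hcoin (c : ℝ≥0∞) : μ ({ω | full X U b ω ∈ reached Q P (d + 1) ∧ bp ω = c} ∩
      {ω | b d ω = true}) = c * μ {ω | full X U b ω ∈ reached Q P (d + 1) ∧ bp ω = c} := by
    rw [hrun.coin d _ (hE c) fun ω hω => ?_, ← setLIntegral_const]
    · refine setLIntegral_congr_fun (hmle _ (hE c)) fun ω hω => ?_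
      rw [← hω.2]
      simp only [hbp, active_eq_cell X U b]
      rw [idx, splitCell_two_mul_add_one _ (heapIndex_pos _ d)]
      congr 2
      rw [← active_eq_cell X U b]
      rfl
    · have := (le_steps_iff Q P X U b ω (d + 1)).2 hω.1
      rw [← ENat.add_one_le_iff (ENat.natCast_ne_top d)]
      exact_mod_cast this
  have hbt : MeasurableSet {ω | b d ω = true} :=
    hrun.measurable_b d (measurableSet_singleton true)
  have h0 : ∀ᵐ ω ∂μ, ¬ ((full X U b ω ∈ reached Q P (d + 1) ∧ bp ω = 0) ∧ b d ω = true) := by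
    have := hcoin 0
    rw [zero_mul] at this
    exact measure_eq_zero_iff_ae_notMem.1 this
  have h1 : ∀ᵐ ω ∂μ, ¬ ((full X U b ω ∈ reached Q P (d + 1) ∧ bp ω = 1) ∧ ¬ b d ω = true) := by
    have := hcoin 1
    rw [one_mul] at this
    have hd := measure_inter_add_sdiff (μ := μ)
      {ω | full X U b ω ∈ reached Q P (d + 1) ∧ bp ω = 1} hbt
    rw [this] at hd
    have hz : μ ({ω | full X U b ω ∈ reached Q P (d + 1) ∧ bp ω = 1} \ {ω | b d ω = true}) = 0 :=
      (ENNReal.add_right_inj (measure_ne_top μ _)).1 (hd.trans (add_zero _).symm)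
    exact measure_eq_zero_iff_ae_notMem.1 hz
  filter_upwards [h0, h1] with ω h0 h1 hr
  refine ⟨fun h => ?_, fun h => ?_⟩
  · by_contra hb
    exact h0 ⟨⟨hr, h⟩, by simpa using hb⟩
  · by_contra hb
    exact h1 ⟨⟨hr, h⟩, hb⟩

/-- The invariants of the run. -/
theorem ae_good [NullSingletonClass P] (hQP : Q ≪ P) (hr : HasUnimodalRatio Q P) (d : ℕ) :
    ∀ᵐ ω ∂μ, full X U b ω ∈ reached Q P d → Good Q P (full X U b ω) d := by
  obtain ⟨G, hG, hmin⟩ := hr.exists_ae_min_le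
  induction d with
  | zero => exact .of_forall fun ω _ => Good.zero hQP _
  | succ d ih =>
    obtain ⟨N, hGN, hNm, hN0⟩ := exists_measurable_superset_of_null (ae_iff.1 hG)
    have hLm : Measurable fun p : Hist × ℝ => level Q P p.1 (d + 1) :=
      (measurable_level (d + 1)).comp measurable_fst
    -- The bad rejections: no mass is left, the proposal is in an exceptional null set, or the
    -- density there exceeds the next level. Each has probability zero, the last because
    -- `rejectWeight` vanishes. The null set is enlarged to `N` for measurability.
    have hB : MeasurableSet ({p : Hist × ℝ | excess Q P univ (level Q P p.1 (d + 1)) = 0} ∪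
        ({p | p.2 ∈ N} ∪ {p | level Q P p.1 (d + 1) < dens Q P p.2})) :=
      (measurableSet_eq_fun ((measurable_excess_level (d + 1)).comp measurable_fst)
        measurable_const).union ((hNm.preimage measurable_snd).union
          (measurableSet_lt hLm ((measurable_dens Q P).comp measurable_snd)))
    have hae := hrun.ae_reached_succ hQP ih hB (fun g x => by
      simp [level_trunc Q P g (le_refl (d + 1))]) fun g hg => by
      rcases eq_or_ne (excess Q P univ (level Q P g (d + 1))) 0 with h0 | h0
      · exact lintegral_rejectWeight_mul_of_excess_eq_zero hg h0 _
      · refine (lintegral_congr_ae ?_).trans lintegral_zero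
        have hNae : ∀ᵐ x ∂(ProbabilityTheory.cond P (cell g d)), x ∉ N :=
          ProbabilityTheory.cond_absolutelyContinuous.ae_le (measure_eq_zero_iff_ae_notMem.1 hN0)
        filter_upwards [hNae] with x hx
        by_cases hlt : level Q P g (d + 1) < dens Q P x
        · have hle := level_le_succ Q P g d
          have : rejectWeight Q P (cell g d) (level Q P g d) x = 0 := by
            have e : level Q P g d + excess Q P (cell g d) (level Q P g d) / P.real (cell g d)
                = level Q P g (d + 1) := rfl
            have h1 := hg.cell_pos
            have h2 := hg.excess_cell_pos
            rw [rejectWeight, e, max_eq_left (by linarith), max_eq_left (by linarith), ← e]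
            field_simp
            ring
          rw [this, ENNReal.ofReal_zero, zero_mul]
        · rw [indicator_of_notMem, mul_zero]
          rintro (h | h | h)
          exacts [h0 h, hx h, hlt h]
    filter_upwards [ih, hae, hrun.ae_coin hQP d] with ω hω h1 h2 hrd
    have hg := hω ((reached_succ (Q := Q) (P := P) d ▸ hrd).1)
    have h1 := h1 hrd
    have h2 := h2 hrd
    simp only [mem_union, mem_ofPred_eq, not_or, not_lt] at h1
    obtain ⟨hne, hxN, hxL⟩ := h1
    have hpos := lt_of_le_of_ne (excess_nonneg Q P univ _) (Ne.symm hne)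
    have hxG : (full X U b ω d).1.1 ∈ G := by
      by_contra h
      exact hxN (hGN h)
    refine hg.succ hQP hpos ?_
    have hbd : (full X U b ω d).2 = b d ω := rfl
    rcases branchProb_zero_or_one hQP hG hmin _ d hg.mem_cell hxG hxL hpos with ⟨hp, h⟩ | ⟨hp, h⟩
    · simpa [cell, hbd, h2.1 hp] using h
    · simpa [cell, hbd, h2.2 hp] using h

end IsGRCSRun

end Run

/-! ### Summation of the drift over all steps. -/

section Run

variable {Ω : Type*} [MeasurableSpace Ω] {Q P : Measure ℝ} [IsProbabilityMeasure Q]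
  [IsProbabilityMeasure P] {μ : Measure Ω} [IsProbabilityMeasure μ] {X U : ℕ → Ω → ℝ}
  {b : ℕ → Ω → Bool}

theorem enat_toENNReal_eq_tsum (n : ℕ∞) :
    (n : ℝ≥0∞) = ∑' d : ℕ, if ((d + 1 : ℕ) : ℕ∞) ≤ n then 1 else 0 := by
  induction n using ENat.recTopCoe with
  | top => simp
  | coe n =>
    rw [tsum_eq_sum (s := Finset.range n)]
    · rw [Finset.sum_congr rfl (g := fun _ => (1 : ℝ≥0∞))]
      · simp
      · intro d hd
        rw [if_pos]
        exact_mod_cast Finset.mem_range.1 hd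
    · intro d hd
      rw [if_neg]
      rw [Nat.cast_le]
      simpa using hd

namespace IsGRCSRun

variable (hrun : IsGRCSRun Q P μ X U b)
include hrun

theorem lintegral_steps_eq_tsum :
    ∫⁻ ω, (steps Q P X U b ω : ℝ≥0∞) ∂μ
      = ∑' d : ℕ, μ (full X U b ⁻¹' reached Q P (d + 1)) := by
  have e (ω : Ω) : (steps Q P X U b ω : ℝ≥0∞)
      = ∑' d : ℕ, (full X U b ⁻¹' reached Q P (d + 1)).indicator (fun _ => 1) ω := by
    rw [enat_toENNReal_eq_tsum]
    refine tsum_congr fun d => ?_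
    by_cases h : full X U b ω ∈ reached Q P (d + 1)
    · rw [if_pos ((le_steps_iff Q P X U b ω (d + 1)).2 h), indicator_of_mem (mem_preimage.2 h)]
    · rw [if_neg (mt (le_steps_iff Q P X U b ω (d + 1)).1 h),
        indicator_of_notMem (mt mem_preimage.1 h)]
  simp_rw [e]
  rw [lintegral_tsum fun d =>
    (measurable_const.indicator (hrun.measurableSet_reached_full _)).aemeasurable]
  refine tsum_congr fun d => ?_
  rw [lintegral_indicator_const (hrun.measurableSet_reached_full _), one_mul]

/-- The expected potential on the event that step `d` is reached. -/
theorem lintegral_potential_succ_le [NullSingletonClass P] (hQP : Q ≪ P)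
    (hr : HasUnimodalRatio Q P)
    (hkl : Integrable (fun x => InformationTheory.klFun (dens Q P x)) P) (d : ℕ) {v : Ω → ℝ≥0∞}
    (hv : ∀ ω, Good Q P (full X U b ω) d → ∫⁻ x,
          ENNReal.ofReal (rejectWeight Q P (cell (full X U b ω) d)
            (level Q P (full X U b ω) d) x)
          * ENNReal.ofReal (Real.log (4 / 3) + nextPotential Q P (full X U b ω) d x)
          ∂(ProbabilityTheory.cond P (cell (full X U b ω) d)) ≤ v ω) :
    ENNReal.ofReal (Real.log (4 / 3)) * μ (full X U b ⁻¹' reached Q P (d + 1))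
      + ∫⁻ ω in full X U b ⁻¹' reached Q P (d + 1),
          ENNReal.ofReal (potential Q P (full X U b ω) (d + 1)) ∂μ
      ≤ ∫⁻ ω in full X U b ⁻¹' reached Q P d, v ω ∂μ := by
  have hf : Measurable fun p : Hist × ℝ =>
      ENNReal.ofReal (Real.log (4 / 3) + nextPotential Q P p.1 d p.2) :=
    (measurable_const.add (measurable_nextPotential d)).ennreal_ofReal
  have key := hrun.lintegral_reached_succ hQP (hrun.ae_good hQP hr d) hf fun g x => by
    simp only [nextPotential, level_trunc Q P g le_rfl, virt_trunc P g le_rfl,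
      cell_trunc g le_rfl]
  have hlog : 0 ≤ Real.log (4 / 3) := Real.log_nonneg (by norm_num)
  rw [← setLIntegral_const, ← lintegral_add_left measurable_const]
  calc ∫⁻ ω in full X U b ⁻¹' reached Q P (d + 1), (ENNReal.ofReal (Real.log (4 / 3))
          + ENNReal.ofReal (potential Q P (full X U b ω) (d + 1))) ∂μ
      = ∫⁻ ω in full X U b ⁻¹' reached Q P (d + 1), ENNReal.ofReal (Real.log (4 / 3)
          + nextPotential Q P (full X U b ω) d (full X U b ω d).1.1) ∂μ := by
        refine setLIntegral_congr_fun_ae (hrun.measurableSet_reached_full _) ?_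
        filter_upwards [hrun.ae_good hQP hr (d + 1)] with ω hω hr
        rw [← potential_succ, ENNReal.ofReal_add hlog
          ((hω hr).potential_nonneg hQP hkl d.succ_ne_zero)]
    _ ≤ ∫⁻ ω in full X U b ⁻¹' reached Q P d, v ω ∂μ := by
        rw [key]
        refine setLIntegral_mono_ae' (hrun.measurableSet_reached_full _) ?_
        filter_upwards [hrun.ae_good hQP hr d] with ω hω hr using hv ω (hω hr)

theorem log_mul_lintegral_steps_le [NullSingletonClass P] (hQP : Q ≪ P)
    (hr : HasUnimodalRatio Q P)
    (hkl : Integrable (fun x => InformationTheory.klFun (dens Q P x)) P) :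
    ENNReal.ofReal (Real.log (4 / 3)) * ∫⁻ ω, (steps Q P X U b ω : ℝ≥0∞) ∂μ
      ≤ ENNReal.ofReal (∫ x, InformationTheory.klFun (dens Q P x) ∂P
          + 4 * Real.log (4 / 3)) := by
  rw [hrun.lintegral_steps_eq_tsum, ← ENNReal.tsum_mul_left]
  -- Keeping the expected potential on the left lets the drift of the next step replace it; it is
  -- dropped only at the end.
  have hsum (n : ℕ) : ∑ d ∈ Finset.range (n + 1),
      ENNReal.ofReal (Real.log (4 / 3)) * μ (full X U b ⁻¹' reached Q P (d + 1))
      + ∫⁻ ω in full X U b ⁻¹' reached Q P (n + 1),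
          ENNReal.ofReal (potential Q P (full X U b ω) (n + 1)) ∂μ
      ≤ ENNReal.ofReal (∫ x, InformationTheory.klFun (dens Q P x) ∂P
          + 4 * Real.log (4 / 3)) := by
    induction n with
    | zero =>
      rw [zero_add, Finset.sum_range_one]
      refine (hrun.lintegral_potential_succ_le hQP hr hkl 0
        fun ω _ => lintegral_nextPotential_zero_le hQP hkl _).trans ?_
      rw [setLIntegral_const]
      exact mul_le_of_le_one_right' prob_le_one
    | succ n ih =>
      rw [Finset.sum_range_succ, add_assoc]
      refine (add_le_add_right ?_ _).trans ih
      exact hrun.lintegral_potential_succ_le hQP hr hkl (n + 1)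
        fun ω hω => lintegral_nextPotential_le hQP hkl n.succ_ne_zero hω
  refine ENNReal.tsum_le_of_sum_range_le fun n => ?_
  refine le_trans ?_ (hsum n)
  exact (Finset.sum_le_sum_of_subset (Finset.range_mono n.le_succ)).trans le_self_add

theorem lintegral_steps_le [NullSingletonClass P] (hQP : Q ≪ P) (hr : HasUnimodalRatio Q P) :
    ∫⁻ ω, (steps Q P X U b ω : ℝ≥0∞) ∂μ
      ≤ ENNReal.ofReal (1 / Real.logb 2 (4 / 3)) * klBits Q P + 4 := by
  have hl2 : 0 < Real.log 2 := Real.log_pos (by norm_num)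
  have hl : 0 < Real.log (4 / 3) := Real.log_pos (by norm_num)
  have hc : 1 / Real.logb 2 (4 / 3) = Real.log 2 / Real.log (4 / 3) := by
    rw [Real.logb, one_div_div]
  have hrw : ENNReal.ofReal (1 / Real.logb 2 (4 / 3)) * klBits Q P
      = InformationTheory.klDiv Q P / ENNReal.ofReal (Real.log (4 / 3)) := by
    have h2 : ENNReal.ofReal (Real.log 2) * (ENNReal.ofReal (Real.log 2))⁻¹ = 1 :=
      ENNReal.mul_inv_cancel (by simpa using hl2) ENNReal.ofReal_ne_top
    rw [hc, klBits, ENNReal.ofReal_div_of_pos hl]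
    generalize ENNReal.ofReal (Real.log 2) = a at h2 ⊢
    generalize ENNReal.ofReal (Real.log (4 / 3)) = c
    generalize InformationTheory.klDiv Q P = k
    rw [div_eq_mul_inv, div_eq_mul_inv, div_eq_mul_inv]
    calc a * c⁻¹ * (k * a⁻¹) = a * a⁻¹ * (k * c⁻¹) := by ring
      _ = k * c⁻¹ := by rw [h2, one_mul]
  rw [hrw]
  -- With infinite divergence the right side is infinite; otherwise `klFun` of the density is
  -- integrable.
  rcases eq_or_ne (InformationTheory.klDiv Q P) ∞ with htop | htop
  · rw [htop, ENNReal.top_div_of_ne_top ENNReal.ofReal_ne_top, top_add]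
    exact le_top
  have hint : Integrable (fun x => InformationTheory.klFun (dens Q P x)) P :=
    (InformationTheory.integrable_klFun_rnDeriv_iff hQP).2
      (InformationTheory.klDiv_ne_top_iff.1 htop).2
  have hkl : ENNReal.ofReal (∫ x, InformationTheory.klFun (dens Q P x) ∂P)
      = InformationTheory.klDiv Q P := by
    rw [← ENNReal.ofReal_toReal htop, InformationTheory.toReal_klDiv_eq_integral_klFun hQP]
    rfl
  have key := hrun.log_mul_lintegral_steps_le hQP hr hint
  rw [ENNReal.ofReal_add (integral_nonneg fun x => InformationTheory.klFun_nonneg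
    (dens_nonneg Q P x)) (by positivity), hkl, ENNReal.ofReal_mul (by norm_num)] at key
  have h0 : ENNReal.ofReal (Real.log (4 / 3)) ≠ 0 := by simpa using hl
  have h4 : ENNReal.ofReal 4 = 4 := by norm_num
  have hdiv : ENNReal.ofReal (Real.log (4 / 3)) / ENNReal.ofReal (Real.log (4 / 3)) = 1 :=
    ENNReal.div_self h0 ENNReal.ofReal_ne_top
  rw [mul_comm, ← ENNReal.le_div_iff_mul_le (.inl h0) (.inl ENNReal.ofReal_ne_top),
    ENNReal.add_div, mul_div_assoc, hdiv, mul_one, h4] at key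
  exact key

end IsGRCSRun

end Run

end GRC

end

theorem theorem3 (Q P : Measure ℝ) [IsProbabilityMeasure Q] [IsProbabilityMeasure P]
    [NullSingletonClass Q] [NullSingletonClass P] (hQP : Q ≪ P) (hr : GRC.HasUnimodalRatio Q P)
    {Ω : Type*} [MeasurableSpace Ω] (μ : Measure Ω) [IsProbabilityMeasure μ]
    (X U : ℕ → Ω → ℝ) (b : ℕ → Ω → Bool) (hrun : GRC.IsGRCSRun Q P μ X U b) :
    (∫⁻ ω, (GRC.steps Q P X U b ω : ℝ≥0∞) ∂μ
        ≤ ENNReal.ofReal (2 / Real.logb 2 (4 / 3)) * GRC.klBits Q P + 4) ∧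
      (∫⁻ ω, (GRC.steps Q P X U b ω : ℝ≥0∞) ∂μ
        ≤ ENNReal.ofReal (1 / Real.logb 2 (4 / 3)) * GRC.klBits Q P + 4) := by
  have h := hrun.lintegral_steps_le hQP hr
  refine ⟨h.trans ?_, h⟩
  have hlog : 0 ≤ Real.logb 2 (4 / 3) := Real.logb_nonneg (by norm_num) (by norm_num)
  -- The first bound only weakens the second, by `1 ≤ 2`.
  gcongr
  norm_num
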